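/- Let $F$ be an algebraically closed field of characteristic $p>2$ and let $n\ge 2$. Let $\mathfrak g=\mathfrak p(n)$ be the Lie superalgebra over $F$ of all block matrices $\begin{pmatrix}a&b\\c&-a^t\end{pmatrix}$ with $a,b,c$ of size $n\times n$, $b$ symmetric and $c$ skew-symmetric, with the supercommutator as bracket; its even part $\mathfrak g_{\bar 0}$ is given by $b=c=0$ and its odd part by $a=0$. Let $\mathfrak g_1\subseteq\mathfrak g$ be the subspace $a=c=0$ and let $\mathfrak g^+=\mathfrak g_{\bar 0}\oplus\mathfrak g_1$. Write $\tilde e_{ij}=e_{ij}-e_{j+n,i+n}\in\mathfrak g_{\bar 0}$ for $1\le i,j\le n$, let $\mathfrak n_0^+$ be the span of the $\tilde e_{ij}$ with $i<j$, and let $h_i=\tilde e_{ii}$. The $p$-mapping $x\mapsto x^{[p]}$ on $\mathfrak g_{\bar 0}$ is the $p$-th power of matrices. For $\chi\in\mathfrak g_{\bar 0}^*$ and $L$ one of $\mathfrak g,\mathfrak g^+,\mathfrak g_{\bar 0}$, let $u_\chi(L)$ be the quotient of the universal enveloping superalgebra $U(L)$ by the two-sided ideal generated by the elements $x^p-x^{[p]}-\chi(x)^p$,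 $x\in\mathfrak g_{\bar 0}$. Assume $\chi(\mathfrak n_0^+)=0$, and let $M$ be a simple $u_\chi(\mathfrak g_{\bar 0})$-module generated by a maximal vector of weight $\mu=(\mu_1,\dots,\mu_n)\in F^n$, that is, by a nonzero vector $v$ with $\mathfrak n_0^+v=0$ and $h_iv=\mu_iv$ for all $i$. View $M$ as a $u_\chi(\mathfrak g^+)$-module by letting $\mathfrak g_1$ act by zero, and let $K_\chi(M)=u_\chi(\mathfrak g)\otimes_{u_\chi(\mathfrak g^+)}M$ be the Kac module. If $$\delta_\mu=\prod_{1\le i<j\le n}(\mu_i-\mu_j+j-i-1)\ne 0\quad\text{in }F,$$ then $K_\chi(M)$ is a simple $u_\chi(\mathfrak g)$-module: it is nonzero and has no submodules, graded or not, other than $0$ and itself. -/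

import Mathlib

open scoped TensorProduct

noncomputable section

/-- A restricted Lie superalgebra sitting inside an associative algebra `A` over `F`: an even
part and an odd part (linear subspaces of `A`, with zero intersection) which are stable under the
supercommutator `[x, y] = x y - (-1)^{|x||y|} y x`, the even part being stable under
the `p`-th power map of `A`.  The super Jacobi identity and the laws of a `p`-mapping
are then inherited from `A`. -/
structure RestrictedLieSuperalgebra (F A : Type*) [CommRing F] [Ring A] [Algebra F A] (p : ℕ) where
  even : Submodule F A
  odd : Submodule F A
  disjoint : Disjoint even odd
  lie_even_even : ∀ x ∈ even, ∀ y ∈ even, x * y - y * x ∈ even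
  lie_even_odd : ∀ x ∈ even, ∀ y ∈ odd, x * y - y * x ∈ odd
  lie_odd_odd : ∀ x ∈ odd, ∀ y ∈ odd, x * y + y * x ∈ even
  pow_mem : ∀ x ∈ even, x ^ p ∈ even

namespace RestrictedLieSuperalgebra

section Enveloping

variable {F A : Type*} [CommRing F] [Ring A] [Algebra F A] {p : ℕ}
variable (L : RestrictedLieSuperalgebra F A p)

/-- The bracket of two even elements. -/
def lie₀₀ (x y : L.even) : L.even :=
  ⟨(x : A) * y - y * x, L.lie_even_even x x.2 y y.2⟩

/-- The bracket of an even and an odd element. -/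
def lie₀₁ (x : L.even) (y : L.odd) : L.odd :=
  ⟨(x : A) * y - y * x, L.lie_even_odd x x.2 y y.2⟩

/-- The (symmetric) bracket of two odd elements. -/
def lie₁₁ (x y : L.odd) : L.even :=
  ⟨(x : A) * y + y * x, L.lie_odd_odd x x.2 y y.2⟩

/-- The `p`-mapping `x ↦ x^[p]` on the even part: the `p`-th power in `A`. -/
def pMap (x : L.even) : L.even := ⟨(x : A) ^ p, L.pow_mem x x.2⟩

/-- The underlying vector space of the Lie superalgebra is the direct sum `even × odd`.
The relations `x y - (-1)^{|x||y|} y x = [x, y]`, for homogeneous `x` and `y`, in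
its tensor algebra. -/
inductive EnvRel : TensorAlgebra F (L.even × L.odd) → TensorAlgebra F (L.even × L.odd) → Prop
  | even_even (x y : L.even) :
      EnvRel
        (TensorAlgebra.ι F (x, 0) * TensorAlgebra.ι F (y, 0)
          - TensorAlgebra.ι F (y, 0) * TensorAlgebra.ι F (x, 0))
        (TensorAlgebra.ι F (L.lie₀₀ x y, 0))
  | even_odd (x : L.even) (y : L.odd) :
      EnvRel
        (TensorAlgebra.ι F (x, 0) * TensorAlgebra.ι F (0, y)
          - TensorAlgebra.ι F (0, y) * TensorAlgebra.ι F (x, 0))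
        (TensorAlgebra.ι F (0, L.lie₀₁ x y))
  | odd_odd (x y : L.odd) :
      EnvRel
        (TensorAlgebra.ι F (0, x) * TensorAlgebra.ι F (0, y)
          + TensorAlgebra.ι F (0, y) * TensorAlgebra.ι F (0, x))
        (TensorAlgebra.ι F (L.lie₁₁ x y, 0))

/-- The universal enveloping (super)algebra `U(L)`. -/
def Env : Type _ := RingQuot L.EnvRel

instance : Ring L.Env := inferInstanceAs (Ring (RingQuot L.EnvRel))

instance : Algebra F L.Env := inferInstanceAs (Algebra F (RingQuot L.EnvRel))

/-- The quotient map from the tensor algebra to `U(L)`. -/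
def mkEnv : TensorAlgebra F (L.even × L.odd) →ₐ[F] L.Env := RingQuot.mkAlgHom F L.EnvRel

/-- The canonical map from `L` to `U(L)`. -/
def envι : (L.even × L.odd) →ₗ[F] L.Env :=
  L.mkEnv.toLinearMap ∘ₗ TensorAlgebra.ι F

/-- The relations `x^p - x^[p] = χ(x)^p`, for `x` even, in `U(L)`. -/
inductive RedRel (χ : Module.Dual F L.even) : L.Env → L.Env → Prop
  | pow (x : L.even) :
      RedRel χ (L.envι (x, 0) ^ p - L.envι (L.pMap x, 0)) (algebraMap F L.Env (χ x ^ p))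

/-- The `χ`-reduced enveloping algebra `u_χ(L)`: the quotient of `U(L)` by the two-sided ideal
generated by the elements `x^p - x^[p] - χ(x)^p`, for `x` even. -/
def Red (χ : Module.Dual F L.even) : Type _ := RingQuot (L.RedRel χ)

variable (χ : Module.Dual F L.even)

instance : Ring (L.Red χ) := inferInstanceAs (Ring (RingQuot (L.RedRel χ)))

instance : Algebra F (L.Red χ) := inferInstanceAs (Algebra F (RingQuot (L.RedRel χ)))

/-- The quotient map from `U(L)` to `u_χ(L)`. -/
def mkRed : L.Env →ₐ[F] L.Red χ := RingQuot.mkAlgHom F (L.RedRel χ)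

/-- The canonical map from the even part of `L` to `u_χ(L)`. -/
def ι₀ : L.even →ₗ[F] L.Red χ :=
  (L.mkRed χ).toLinearMap ∘ₗ L.envι ∘ₗ LinearMap.inl F L.even L.odd

/-- The canonical map from the odd part of `L` to `u_χ(L)`. -/
def ι₁ : L.odd →ₗ[F] L.Red χ :=
  (L.mkRed χ).toLinearMap ∘ₗ L.envι ∘ₗ LinearMap.inr F L.even L.odd

theorem ι₀_mul_ι₀ (x y : L.even) :
    L.ι₀ χ x * L.ι₀ χ y - L.ι₀ χ y * L.ι₀ χ x = L.ι₀ χ (L.lie₀₀ x y) := by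
  have h : L.mkEnv _ = L.mkEnv _ := RingQuot.mkAlgHom_rel F (EnvRel.even_even (L := L) x y)
  simp only [map_sub, map_mul] at h
  simpa [ι₀, envι] using congrArg (L.mkRed χ) h

theorem ι₀_mul_ι₁ (x : L.even) (y : L.odd) :
    L.ι₀ χ x * L.ι₁ χ y - L.ι₁ χ y * L.ι₀ χ x = L.ι₁ χ (L.lie₀₁ x y) := by
  have h : L.mkEnv _ = L.mkEnv _ := RingQuot.mkAlgHom_rel F (EnvRel.even_odd (L := L) x y)
  simp only [map_sub, map_mul] at h
  simpa [ι₀, ι₁, envι] using congrArg (L.mkRed χ) h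

theorem ι₁_mul_ι₁ (x y : L.odd) :
    L.ι₁ χ x * L.ι₁ χ y + L.ι₁ χ y * L.ι₁ χ x = L.ι₀ χ (L.lie₁₁ x y) := by
  have h : L.mkEnv _ = L.mkEnv _ := RingQuot.mkAlgHom_rel F (EnvRel.odd_odd (L := L) x y)
  simp only [map_add, map_mul] at h
  simpa [ι₀, ι₁, envι] using congrArg (L.mkRed χ) h

theorem ι₀_pow (x : L.even) :
    L.ι₀ χ x ^ p - L.ι₀ χ (L.pMap x) = algebraMap F (L.Red χ) (χ x ^ p) := by
  have h : L.mkRed χ _ = L.mkRed χ _ := RingQuot.mkAlgHom_rel F (RedRel.pow (χ := χ) x)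
  simp only [map_sub, map_pow, AlgHom.commutes] at h
  simpa [ι₀] using h

/-- The universal property of `u_χ(L)`. -/
def lift {B : Type*} [Ring B] [Algebra F B] (f₀ : L.even →ₗ[F] B) (f₁ : L.odd →ₗ[F] B)
    (h₀₀ : ∀ x y, f₀ x * f₀ y - f₀ y * f₀ x = f₀ (L.lie₀₀ x y))
    (h₀₁ : ∀ x y, f₀ x * f₁ y - f₁ y * f₀ x = f₁ (L.lie₀₁ x y))
    (h₁₁ : ∀ x y, f₁ x * f₁ y + f₁ y * f₁ x = f₀ (L.lie₁₁ x y))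
    (hp : ∀ x, f₀ x ^ p - f₀ (L.pMap x) = algebraMap F B (χ x ^ p)) :
    L.Red χ →ₐ[F] B :=
  let φ : L.Env →ₐ[F] B :=
    RingQuot.liftAlgHom F ⟨TensorAlgebra.lift F (f₀.coprod f₁), by
      intro a b hab
      cases hab with
      | even_even x y => simpa using h₀₀ x y
      | even_odd x y => simpa using h₀₁ x y
      | odd_odd x y => simpa using h₁₁ x y⟩
  have hφ : ∀ z, φ (L.envι z) = f₀ z.1 + f₁ z.2 := fun z =>
    (RingQuot.liftAlgHom_mkAlgHom_apply F _ _ _).trans (by simp)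
  RingQuot.liftAlgHom F ⟨φ, by
    intro a b hab
    cases hab with
    | pow x => simpa [hφ] using hp x⟩

theorem lift_ι₀ {B : Type*} [Ring B] [Algebra F B] (f₀ : L.even →ₗ[F] B) (f₁ : L.odd →ₗ[F] B)
    (h₀₀ h₀₁ h₁₁ hp) (x : L.even) : L.lift χ f₀ f₁ h₀₀ h₀₁ h₁₁ hp (L.ι₀ χ x) = f₀ x :=
  (RingQuot.liftAlgHom_mkAlgHom_apply F _ _ _).trans
    ((RingQuot.liftAlgHom_mkAlgHom_apply F _ _ _).trans (by simp))

theorem lift_ι₁ {B : Type*} [Ring B] [Algebra F B] (f₀ : L.even →ₗ[F] B) (f₁ : L.odd →ₗ[F] B)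
    (h₀₀ h₀₁ h₁₁ hp) (x : L.odd) : L.lift χ f₀ f₁ h₀₀ h₀₁ h₁₁ hp (L.ι₁ χ x) = f₁ x :=
  (RingQuot.liftAlgHom_mkAlgHom_apply F _ _ _).trans
    ((RingQuot.liftAlgHom_mkAlgHom_apply F _ _ _).trans (by simp))

end Enveloping

end RestrictedLieSuperalgebra

namespace Periplectic

open Matrix RestrictedLieSuperalgebra

section Algebra

variable (F : Type*) [Field F] (n : ℕ)

/-- The `2n × 2n` matrices over `F`, in `n × n` blocks. -/
abbrev Mat : Type _ := Matrix (Fin n ⊕ Fin n) (Fin n ⊕ Fin n) F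

/-- The even part `𝔤₀` of `𝔭(n)`: the block matrices `(a, 0; 0, -aᵗ)`. -/
def g₀ : Submodule F (Mat F n) where
  carrier := {x | ∃ a : Matrix (Fin n) (Fin n) F, x = fromBlocks a 0 0 (-aᵀ)}
  add_mem' := by
    rintro _ _ ⟨a, rfl⟩ ⟨b, rfl⟩
    exact ⟨a + b, by simp [fromBlocks_add, add_comm]⟩
  zero_mem' := ⟨0, by simp⟩
  smul_mem' := by
    rintro c _ ⟨a, rfl⟩
    exact ⟨c • a, by simp [fromBlocks_smul]⟩

/-- The subspace `𝔤₁`: the block matrices `(0, b; 0, 0)` with `b` symmetric. -/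
def gPos : Submodule F (Mat F n) where
  carrier := {x | ∃ b : Matrix (Fin n) (Fin n) F, bᵀ = b ∧ x = fromBlocks 0 b 0 0}
  add_mem' := by
    rintro _ _ ⟨a, ha, rfl⟩ ⟨b, hb, rfl⟩
    exact ⟨a + b, by simp [ha, hb], by simp [fromBlocks_add]⟩
  zero_mem' := ⟨0, by simp⟩
  smul_mem' := by
    rintro c _ ⟨a, ha, rfl⟩
    exact ⟨c • a, by simp [ha], by simp [fromBlocks_smul]⟩

/-- The odd part `𝔤₋₁ ⊕ 𝔤₁` of `𝔭(n)`: the block matrices `(0, b; c, 0)` with `b` symmetric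
and `c` skew-symmetric. -/
def gOdd : Submodule F (Mat F n) where
  carrier := {x | ∃ b c : Matrix (Fin n) (Fin n) F, bᵀ = b ∧ cᵀ = -c ∧ x = fromBlocks 0 b c 0}
  add_mem' := by
    rintro _ _ ⟨b, c, hb, hc, rfl⟩ ⟨b', c', hb', hc', rfl⟩
    exact ⟨b + b', c + c', by simp [hb, hb'], by simp [hc, hc', add_comm],
      by simp [fromBlocks_add]⟩
  zero_mem' := ⟨0, 0, by simp⟩
  smul_mem' := by
    rintro r _ ⟨b, c, hb, hc, rfl⟩
    exact ⟨r • b, r • c, by simp [hb], by simp [hc], by simp [fromBlocks_smul]⟩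

theorem gPos_le_gOdd : gPos F n ≤ gOdd F n := by
  rintro _ ⟨b, hb, rfl⟩
  exact ⟨b, 0, hb, by simp, rfl⟩

theorem disjoint_g₀_gOdd : Disjoint (g₀ F n) (gOdd F n) := by
  rw [Submodule.disjoint_def]
  rintro _ ⟨a, rfl⟩ ⟨b, c, -, -, h⟩
  obtain ⟨rfl, -, -, -⟩ := fromBlocks_inj.1 h
  simp

theorem lie_g₀_g₀ : ∀ x ∈ g₀ F n, ∀ y ∈ g₀ F n, x * y - y * x ∈ g₀ F n := by
  rintro _ ⟨a, rfl⟩ _ ⟨b, rfl⟩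
  exact ⟨a * b - b * a, by simp [fromBlocks_multiply, sub_eq_add_neg, fromBlocks_neg,
    fromBlocks_add, add_comm]⟩

theorem lie_g₀_gPos : ∀ x ∈ g₀ F n, ∀ y ∈ gPos F n, x * y - y * x ∈ gPos F n := by
  rintro _ ⟨a, rfl⟩ _ ⟨b, hb, rfl⟩
  exact ⟨a * b + b * aᵀ, by simp [hb, add_comm], by
    simp [fromBlocks_multiply, sub_eq_add_neg, fromBlocks_neg, fromBlocks_add]⟩

theorem lie_g₀_gOdd : ∀ x ∈ g₀ F n, ∀ y ∈ gOdd F n, x * y - y * x ∈ gOdd F n := by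
  rintro _ ⟨a, rfl⟩ _ ⟨b, c, hb, hc, rfl⟩
  exact ⟨a * b + b * aᵀ, -(aᵀ * c) - c * a, by simp [hb, add_comm],
    by simp [hc], by
    simp [fromBlocks_multiply, sub_eq_add_neg, fromBlocks_neg, fromBlocks_add]⟩

theorem lie_gPos_gPos : ∀ x ∈ gPos F n, ∀ y ∈ gPos F n, x * y + y * x = 0 := by
  rintro _ ⟨a, -, rfl⟩ _ ⟨b, -, rfl⟩
  simp [fromBlocks_multiply]

theorem lie_gOdd_gOdd : ∀ x ∈ gOdd F n, ∀ y ∈ gOdd F n, x * y + y * x ∈ g₀ F n := by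
  rintro _ ⟨b, c, hb, hc, rfl⟩ _ ⟨b', c', hb', hc', rfl⟩
  exact ⟨b * c' + b' * c, by
    simp [fromBlocks_multiply, fromBlocks_add, hb, hc, hb', hc', add_comm]⟩

theorem fromBlocks_diag_pow (a d : Matrix (Fin n) (Fin n) F) (k : ℕ) :
    fromBlocks a 0 0 d ^ k = fromBlocks (a ^ k) 0 0 (d ^ k) := by
  induction k with
  | zero => simp
  | succ k ih => simp [pow_succ, ih, fromBlocks_multiply]

theorem pow_mem_g₀ (p : ℕ) [Fact p.Prime] [CharP F p] : ∀ x ∈ g₀ F n, x ^ p ∈ g₀ F n := by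
  rintro _ ⟨a, rfl⟩
  refine ⟨a ^ p, ?_⟩
  have h : (-aᵀ) ^ p = -(aᵀ ^ p) := by
    rcases (Fact.out : p.Prime).eq_two_or_odd' with rfl | hp
    · have h2 : (2 : F) = 0 := by exact_mod_cast CharP.cast_eq_zero F 2
      have hn : ∀ m : Matrix (Fin n) (Fin n) F, -m = m := by
        intro m
        ext i j
        have : m i j + m i j = 0 := by rw [← two_mul, h2, zero_mul]
        simpa using (eq_neg_of_add_eq_zero_left this).symm
      rw [hn, hn]
    · exact hp.neg_pow _
  rw [fromBlocks_diag_pow, h, transpose_pow]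

end Algebra

section Superalgebras

variable (F : Type*) [Field F] (n p : ℕ) [Fact p.Prime] [CharP F p]

/-- The restricted Lie superalgebra `𝔤 = 𝔭(n)`. -/
abbrev g : RestrictedLieSuperalgebra F (Mat F n) p where
  even := g₀ F n
  odd := gOdd F n
  disjoint := disjoint_g₀_gOdd F n
  lie_even_even := lie_g₀_g₀ F n
  lie_even_odd := lie_g₀_gOdd F n
  lie_odd_odd := lie_gOdd_gOdd F n
  pow_mem := pow_mem_g₀ F n p

/-- The subalgebra `𝔤⁺ = 𝔤₀ ⊕ 𝔤₁` of `𝔭(n)`. -/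
abbrev gPlus : RestrictedLieSuperalgebra F (Mat F n) p where
  even := g₀ F n
  odd := gPos F n
  disjoint := (disjoint_g₀_gOdd F n).mono_right (gPos_le_gOdd F n)
  lie_even_even := lie_g₀_g₀ F n
  lie_even_odd := lie_g₀_gPos F n
  lie_odd_odd x hx y hy := by rw [lie_gPos_gPos F n x hx y hy]; exact zero_mem _
  pow_mem := pow_mem_g₀ F n p

/-- The restricted Lie algebra `𝔤₀`, as a Lie superalgebra with zero odd part. -/
abbrev gZero : RestrictedLieSuperalgebra F (Mat F n) p where
  even := g₀ F n
  odd := ⊥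
  disjoint := disjoint_bot_right
  lie_even_even := lie_g₀_g₀ F n
  lie_even_odd x _ y hy := by rw [(Submodule.mem_bot F).1 hy]; simp
  lie_odd_odd x hx y hy := by
    rw [(Submodule.mem_bot F).1 hx, (Submodule.mem_bot F).1 hy]; simp
  pow_mem := pow_mem_g₀ F n p

variable (χ : Module.Dual F (g₀ F n))

/-- The algebra map `u_χ(𝔤⁺) → u_χ(𝔤)` induced by the inclusion of `𝔤⁺` in `𝔤`. -/
def incl : (gPlus F n p).Red χ →ₐ[F] (g F n p).Red χ :=
  (gPlus F n p).lift χ ((g F n p).ι₀ χ)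
    ((g F n p).ι₁ χ ∘ₗ Submodule.inclusion (gPos_le_gOdd F n))
    ((g F n p).ι₀_mul_ι₀ χ)
    (fun x y => (g F n p).ι₀_mul_ι₁ χ x (Submodule.inclusion (gPos_le_gOdd F n) y))
    (fun x y => (g F n p).ι₁_mul_ι₁ χ (Submodule.inclusion (gPos_le_gOdd F n) x)
      (Submodule.inclusion (gPos_le_gOdd F n) y))
    ((g F n p).ι₀_pow χ)

/-- The algebra map `u_χ(𝔤⁺) → u_χ(𝔤₀)` which is the identity on `𝔤₀` and kills `𝔤₁`.
Through it a `u_χ(𝔤₀)`-module is viewed as a `u_χ(𝔤⁺)`-module with `𝔤₁` acting by zero. -/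
def proj : (gPlus F n p).Red χ →ₐ[F] (gZero F n p).Red χ :=
  (gPlus F n p).lift χ ((gZero F n p).ι₀ χ) 0
    ((gZero F n p).ι₀_mul_ι₀ χ)
    (fun x y => by simp)
    (fun x y => by
      have h : (gPlus F n p).lie₁₁ x y = 0 := Subtype.ext (lie_gPos_gPos F n x x.2 y y.2)
      rw [h, map_zero]
      simp)
    ((gZero F n p).ι₀_pow χ)

/-- The `u_χ(𝔤)`-submodule of `u_χ(𝔤) ⊗_F M` spanned by the elements `a s ⊗ m - a ⊗ s m`, for
`s` in `u_χ(𝔤⁺)`. -/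
def balance (M : Type*) [AddCommGroup M] [Module F M] [Module ((gZero F n p).Red χ) M] :
    Submodule ((g F n p).Red χ) ((g F n p).Red χ ⊗[F] M) :=
  Submodule.span _ {t | ∃ (a : (g F n p).Red χ) (s : (gPlus F n p).Red χ) (m : M),
    t = (a * incl F n p χ s) ⊗ₜ[F] m - a ⊗ₜ[F] (proj F n p χ s • m)}

/-- The Kac module `K_χ(M) = u_χ(𝔤) ⊗_{u_χ(𝔤⁺)} M`, where `𝔤₁` acts by zero on `M`. -/
abbrev KacModule (M : Type*) [AddCommGroup M] [Module F M] [Module ((gZero F n p).Red χ) M] :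
    Type _ :=
  ((g F n p).Red χ ⊗[F] M) ⧸ balance F n p χ M

end Superalgebras

section Weights

variable {F : Type*} [Field F] {n : ℕ}

variable (F) in
/-- The element `e_{ij} - e_{j+n,i+n}` of `𝔤₀`. -/
def e (i j : Fin n) : g₀ F n :=
  ⟨fromBlocks (Matrix.single i j 1) 0 0 (-(Matrix.single i j 1)ᵀ), ⟨_, rfl⟩⟩

variable (F n) in
/-- The subalgebra `𝔫₀⁺` of `𝔤₀`, spanned by the positive root vectors. -/
def nPlus : Submodule F (g₀ F n) :=
  Submodule.span F {x | ∃ i j : Fin n, i < j ∧ x = e F i j}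

/-- `v` is a maximal vector of weight `μ = ∑ μ_i ε_i` in a `u_χ(𝔤₀)`-module. -/
def IsMaximalVector (p : ℕ) [Fact p.Prime] [CharP F p] (χ : Module.Dual F (g₀ F n))
    {M : Type*} [AddCommGroup M] [Module F M] [Module ((gZero F n p).Red χ) M]
    (v : M) (μ : Fin n → F) : Prop :=
  v ≠ 0 ∧ (∀ x ∈ nPlus F n, (gZero F n p).ι₀ χ x • v = 0) ∧
    ∀ i, (gZero F n p).ι₀ χ (e F i i) • v = μ i • v

/-- The scalar `δ_μ = ∏_{i<j} (μ_i - μ_j + j - i - 1)`. -/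
def delta (μ : Fin n → F) : F :=
  ∏ i, ∏ j ∈ Finset.Ioi i, (μ i - μ j + ((j : ℕ) : F) - ((i : ℕ) : F) - 1)

end Weights

end Periplectic

end

/-! Write `Y` for the product of the root vectors `y_{ij} = e_{ij} - e_{ji}`, `i < j`, of `𝔤₋₁`, in
lexicographic order. These vectors anticommute and square to zero, and they span `𝔤₋₁`, so the Kac
module `K` is the sum of the subspaces `y_{P₁} ⋯ y_{Pₖ} M`. Hence multiplying a nonzero element of a
submodule `N` by suitable `y_{ij}` gives some `Y m ∈ N` with `m ≠ 0`. As `𝔤₀` commutes with `Y` up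
to multiples of `Y` and `M` is simple, all of `Y M` lies in `N`; in particular `Y v ∈ N`.

The factors of `Y` are then stripped from the left: if `Y' v` is what remains to the right of
`y_{ij}`, then `x_{ij} = e_{ij} + e_{ji} ∈ 𝔤₁` kills `Y' v`, so `x_{ij} y_{ij} Y' v` equals
`[x_{ij}, y_{ij}] Y' v = (h_j - h_i) Y' v = -(μ_i - μ_j + j - i - 1) Y' v`. All these scalars are
units when `δ_μ ≠ 0`, so `v ∈ N` and `N = K`.

That `K ≠ 0` needs `M → K` to be nonzero. It is injective because `u_χ(𝔤)` acts on `Λ(𝔤₋₁) ⊗ M` with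
`𝔤₁` killing `1 ⊗ M`, which gives a map from `K` sending `1 ⊗ m` to `1 ⊗ m`. -/

noncomputable section

section CharP

variable {A : Type*} [Ring A]

theorem sub_pow_char_of_commute_of_algebra (F : Type*) [CommRing F] [Algebra F A] (p : ℕ)
    [hp : Fact p.Prime] [CharP F p] {x y : A} (h : Commute x y) :
    (x - y) ^ p = x ^ p - y ^ p := by
  cases subsingleton_or_nontrivial A
  · exact Subsingleton.elim _ _
  · have : CharP A p := (CharP.charP_iff_prime_eq_zero hp.out).2 <| by
      rw [← map_natCast (algebraMap F A), CharP.cast_eq_zero, map_zero]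
    exact sub_pow_char_of_commute _ h

theorem neg_pow_char_of_algebra (F : Type*) [CommRing F] [Algebra F A] (p : ℕ)
    [hp : Fact p.Prime] [CharP F p] (x : A) : (-x) ^ p = -x ^ p := by
  simpa [hp.out.ne_zero] using sub_pow_char_of_commute_of_algebra F p (Commute.zero_left x)

theorem pow_char_mul_sub_mul_pow_char {F V : Type*} [CommRing F] [Algebra F A] [AddCommGroup V]
    [Module F V] {p : ℕ} [Fact p.Prime] [CharP F p] {a b : A} {T : V →ₗ[F] A}
    {D : Module.End F V} (h : ∀ c, a * T c - T c * b = T (D c)) (c : V) :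
    a ^ p * T c - T c * b ^ p = T ((D ^ p) c) := by
  have hcomp : (LinearMap.mulLeft F a - LinearMap.mulRight F b) ∘ₗ T = T ∘ₗ D :=
    LinearMap.ext h
  have hpow := LinearMap.congr_fun (Module.End.commute_pow_left_of_commute hcomp p) c
  rwa [sub_pow_char_of_commute_of_algebra F p (LinearMap.commute_mulLeft_right a b),
    LinearMap.pow_mulLeft, LinearMap.pow_mulRight] at hpow

end CharP

/-- The module `Λ(V) ⊗ M`, which for `V = 𝔤₋₁` models the Kac module of `M`. -/
def ExteriorTensor (R V M : Type*) [CommRing R] [AddCommGroup V] [Module R V] [AddCommGroup M]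
    [Module R M] : Type _ :=
  ExteriorAlgebra R V ⊗[R] M

namespace ExteriorTensor

variable (R V M : Type*) [CommRing R] [AddCommGroup V] [Module R V] [AddCommGroup M] [Module R M]

instance : AddCommGroup (ExteriorTensor R V M) :=
  inferInstanceAs (AddCommGroup (ExteriorAlgebra R V ⊗[R] M))

instance : Module R (ExteriorTensor R V M) :=
  inferInstanceAs (Module R (ExteriorAlgebra R V ⊗[R] M))

/-- The bilinear map `(x, m) ↦ x ⊗ m`. -/
def mk : ExteriorAlgebra R V →ₗ[R] M →ₗ[R] ExteriorTensor R V M :=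
  TensorProduct.mk R _ M

/-- The embedding `m ↦ 1 ⊗ m` of `M` in `Λ(V) ⊗ M`. -/
def of : M →ₗ[R] ExteriorTensor R V M :=
  mk R V M 1

/-- Left multiplication by the vectors of `V` on `Λ(V) ⊗ M`. -/
def wedge : V →ₗ[R] Module.End R (ExteriorTensor R V M) :=
  LinearMap.rTensorHom M ∘ₗ LinearMap.mul R (ExteriorAlgebra R V) ∘ₗ ExteriorAlgebra.ι R

variable {R V M}

theorem wedge_mk (c : V) (x : ExteriorAlgebra R V) (m : M) :
    wedge R V M c (mk R V M x m) = mk R V M (ExteriorAlgebra.ι R c * x) m := rfl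

theorem hom_ext {N : Type*} [AddCommGroup N] [Module R N] {S T : ExteriorTensor R V M →ₗ[R] N}
    (h : ∀ x m, S (mk R V M x m) = T (mk R V M x m)) : S = T :=
  TensorProduct.ext' h

theorem wedge_wedge_self (c : V) (k : ExteriorTensor R V M) :
    wedge R V M c (wedge R V M c k) = 0 := by
  suffices h : wedge R V M c ∘ₗ wedge R V M c = 0 from LinearMap.congr_fun h k
  exact hom_ext fun x m => by simp [wedge_mk, ← mul_assoc]

theorem wedge_wedge_add_wedge_wedge (c d : V) (k : ExteriorTensor R V M) :
    wedge R V M c (wedge R V M d k) + wedge R V M d (wedge R V M c k) = 0 := by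
  simpa [wedge_wedge_self, add_comm] using wedge_wedge_self (c + d) k

variable (R V M) in
theorem of_injective : Function.Injective (of R V M) := by
  let r : ExteriorTensor R V M → M :=
    TensorProduct.lid R M ∘ ExteriorAlgebra.algebraMapInv.toLinearMap.rTensor M
  have hr (m : M) : r (of R V M m) = m := by
    change TensorProduct.lid R M (LinearMap.rTensor M _ (1 ⊗ₜ m)) = m
    simp
  exact Function.LeftInverse.injective hr

theorem end_ext {S T : Module.End R (ExteriorTensor R V M)} (ε : R)
    (G : V → ExteriorTensor R V M → ExteriorTensor R V M)
    (h1 : ∀ m, S (of R V M m) = T (of R V M m))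
    (hS : ∀ c k, S (wedge R V M c k) = ε • wedge R V M c (S k) + G c k)
    (hT : ∀ c k, T (wedge R V M c k) = ε • wedge R V M c (T k) + G c k) : S = T := by
  refine hom_ext fun x m => ?_
  induction x using CliffordAlgebra.left_induction with
  | algebraMap r =>
    simpa [Algebra.algebraMap_eq_smul_one, of] using congrArg (r • ·) (h1 m)
  | add x y hx hy => simp [hx, hy]
  | ι_mul x c hx =>
    exact (hS c (mk R V M x m)).trans (hx ▸ (hT c (mk R V M x m)).symm)

section Extend

variable (ε : R) (f : M →ₗ[R] ExteriorTensor R V M)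
  (G : V →ₗ[R] Module.End R (ExteriorTensor R V M))

/-- One step of the recursion `T (c ∧ k) = ε (c ∧ T k) + G c k` defining an operator `T` on
`Λ(V) ⊗ M`: the second component of a pair `(x, φ)` is the map `m ↦ T (x ⊗ m)`. -/
def extendStep : V →ₗ[R] ExteriorAlgebra R V × (M →ₗ[R] ExteriorTensor R V M) →ₗ[R]
    M →ₗ[R] ExteriorTensor R V M :=
  LinearMap.mk₂ R
    (fun c x => ε • (wedge R V M c ∘ₗ x.2) + G c ∘ₗ mk R V M x.1)
    (fun c d x => by
      ext m
      simp only [map_add, LinearMap.add_apply, LinearMap.smul_apply, LinearMap.comp_apply, smul_add]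
      abel)
    (fun r c x => by ext m; simp [smul_comm ε r])
    (fun c x y => by
      ext m
      simp only [Prod.snd_add, Prod.fst_add, map_add, LinearMap.add_apply, LinearMap.smul_apply,
        LinearMap.comp_apply, smul_add]
      abel)
    (fun r c x => by ext m; simp [smul_comm ε r])

variable {ε f G} in
theorem extendStep_extendStep
    (hG : ∀ c k, ε • wedge R V M c (G c k) + G c (wedge R V M c k) = 0)
    (c : V) (x : ExteriorAlgebra R V) (φ : M →ₗ[R] ExteriorTensor R V M) :
    extendStep ε G c (CliffordAlgebra.ι 0 c * x, extendStep ε G c (x, φ)) =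
      (0 : QuadraticForm R V) c • φ := by
  ext m
  simpa [extendStep, wedge_wedge_self, wedge_mk] using hG c (mk R V M x m)

variable (hG : ∀ c k, ε • wedge R V M c (G c k) + G c (wedge R V M c k) = 0)

/-- The operator `T` on `Λ(V) ⊗ M` with `T (1 ⊗ m) = f m` and
`T (c ∧ k) = ε (c ∧ T k) + G c k`. -/
def extend : Module.End R (ExteriorTensor R V M) :=
  TensorProduct.lift
    (CliffordAlgebra.foldr' 0 (extendStep ε G) (extendStep_extendStep hG) f)

theorem extend_of (m : M) : extend ε f G hG (of R V M m) = f m := by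
  have h := CliffordAlgebra.foldr'_algebraMap 0 (extendStep ε G) (extendStep_extendStep hG) f 1
  rw [map_one, one_smul] at h
  exact LinearMap.congr_fun h m

theorem extend_wedge (c : V) (k : ExteriorTensor R V M) :
    extend ε f G hG (wedge R V M c k) = ε • wedge R V M c (extend ε f G hG k) + G c k := by
  suffices h : extend ε f G hG ∘ₗ wedge R V M c =
      ε • (wedge R V M c ∘ₗ extend ε f G hG) + G c from LinearMap.congr_fun h k
  exact hom_ext fun x m => LinearMap.congr_fun
    (CliffordAlgebra.foldr'_ι_mul 0 (extendStep ε G) (extendStep_extendStep hG) f c x) m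

end Extend

end ExteriorTensor

attribute [local instance] LieRing.ofAssociativeRing

/-- The axioms for the bracket `𝔤₁ × 𝔤₋₁ → 𝔤₀` of a `ℤ`-graded Lie superalgebra
`𝔤 = 𝔤₋₁ ⊕ 𝔤₀ ⊕ 𝔤₁` with `V = 𝔤₋₁`, `E = 𝔤₀` and `P = 𝔤₁`: the super Jacobi identities that are not
already contained in the structures of `E`-modules on `V` and `P`. -/
structure IsGradedBracket {R E V P : Type*} [CommRing R] [LieRing E] [LieAlgebra R E]
    [AddCommGroup V] [Module R V] [LieRingModule E V] [AddCommGroup P] [Module R P]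
    [LieRingModule E P] (B : P →ₗ[R] V →ₗ[R] E) : Prop where
  lie_apply (s : E) (b : P) (c : V) : ⁅s, B b c⁆ = B ⁅s, b⁆ c + B b ⁅s, c⁆
  apply_lie_self (b : P) (c : V) : ⁅B b c, c⁆ = 0
  apply_lie_add (b d : P) (c : V) : ⁅B b c, d⁆ + ⁅B d c, b⁆ = 0

namespace ExteriorTensor

variable {R E V P M : Type*} [CommRing R] [LieRing E] [LieAlgebra R E]
  [AddCommGroup V] [Module R V] [LieRingModule E V] [LieModule R E V]
  [AddCommGroup P] [Module R P] [LieRingModule E P] [AddCommGroup M] [Module R M]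

variable (V) (ρ : E →ₗ⁅R⁆ Module.End R M)

/-- The operator by which a single `s ∈ 𝔤₀` acts on `Λ(𝔤₋₁) ⊗ M`, from which the representation
`evenOp` is built. -/
def evenOpFun (s : E) : Module.End R (ExteriorTensor R V M) :=
  extend 1 (of R V M ∘ₗ ρ s) (wedge R V M ∘ₗ LieModule.toEnd R E V s) fun c k => by
    simpa using wedge_wedge_add_wedge_wedge c ⁅s, c⁆ k

theorem evenOpFun_of (s : E) (m : M) : evenOpFun V ρ s (of R V M m) = of R V M (ρ s m) :=
  extend_of ..

variable {V} in
theorem evenOpFun_wedge (s : E) (c : V) (k : ExteriorTensor R V M) :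
    evenOpFun V ρ s (wedge R V M c k) =
      (1 : R) • wedge R V M c (evenOpFun V ρ s k) + wedge R V M ⁅s, c⁆ k :=
  extend_wedge ..

/-- The action of `𝔤₀` on `Λ(𝔤₋₁) ⊗ M`, given by `ρ` on `M` and by derivations in `Λ(𝔤₋₁)`. -/
def evenOp : E →ₗ⁅R⁆ Module.End R (ExteriorTensor R V M) where
  toFun := evenOpFun V ρ
  map_add' s t := end_ext 1 (fun c => wedge R V M ⁅s + t, c⁆)
    (fun m => by simp [evenOpFun_of]) (fun c k => evenOpFun_wedge ρ (s + t) c k)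
    fun c k => by
      simp only [LinearMap.add_apply, evenOpFun_wedge, one_smul, map_add, add_lie]
      abel
  map_smul' r s := end_ext 1 (fun c => wedge R V M ⁅r • s, c⁆)
    (fun m => by simp [evenOpFun_of]) (fun c k => evenOpFun_wedge ρ (r • s) c k)
    fun c k => by simp [evenOpFun_wedge]
  map_lie' {s t} := end_ext 1 (fun c => wedge R V M ⁅⁅s, t⁆, c⁆)
    (fun m => by simp [evenOpFun_of, LieRing.of_associative_ring_bracket])
    (fun c k => evenOpFun_wedge ρ ⁅s, t⁆ c k)
    fun c k => by
      simp only [LieRing.of_associative_ring_bracket, LinearMap.sub_apply, Module.End.mul_apply,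
        evenOpFun_wedge, one_smul, map_add, map_sub, lie_lie]
      abel

theorem evenOp_of (s : E) (m : M) : evenOp V ρ s (of R V M m) = of R V M (ρ s m) :=
  evenOpFun_of V ρ s m

variable {V}

theorem evenOp_wedge (s : E) (c : V) (k : ExteriorTensor R V M) :
    evenOp V ρ s (wedge R V M c k) = wedge R V M c (evenOp V ρ s k) + wedge R V M ⁅s, c⁆ k := by
  rw [← one_smul R (wedge R V M c (evenOp V ρ s k))]
  exact evenOpFun_wedge ρ s c k

theorem evenOp_pow_char_sub {p : ℕ} [Fact p.Prime] [CharP R p] {s t : E} {r : R}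
    (hV : LieModule.toEnd R E V s ^ p = LieModule.toEnd R E V t)
    (hM : ρ s ^ p - ρ t = algebraMap R _ r) :
    evenOp V ρ s ^ p - evenOp V ρ t = algebraMap R _ r := by
  have hpow_of (m : M) : (evenOp V ρ s ^ p) (of R V M m) = of R V M ((ρ s ^ p) m) :=
    LinearMap.congr_fun (Module.End.commute_pow_left_of_commute (f := of R V M) (g := ρ s)
      (LinearMap.ext (evenOp_of V ρ s)) p) m
  have hpow_wedge (c : V) : evenOp V ρ s ^ p * wedge R V M c - wedge R V M c * evenOp V ρ s ^ p =
      wedge R V M ⁅t, c⁆ := by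
    rw [pow_char_mul_sub_mul_pow_char (D := LieModule.toEnd R E V s) fun d =>
      LinearMap.ext fun k => by simp [evenOp_wedge], hV, LieModule.toEnd_apply_apply]
  refine end_ext 1 0 (fun m => ?_) (fun c k => ?_) fun c k => by simp
  · have h := congrArg (of R V M) (LinearMap.congr_fun hM m)
    simpa [hpow_of, evenOp_of] using h
  · have h := LinearMap.congr_fun (hpow_wedge c) k
    simp only [LinearMap.sub_apply, Module.End.mul_apply, sub_eq_iff_eq_add] at h
    simp only [LinearMap.sub_apply, h, evenOp_wedge, map_sub, one_smul, Pi.zero_apply, add_zero]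
    abel

variable {B : P →ₗ[R] V →ₗ[R] E} (hB : IsGradedBracket B)

/-- The operator by which a single `b ∈ 𝔤₁` acts on `Λ(𝔤₋₁) ⊗ M`: it is odd, whence the sign `-1`,
and vanishes on `1 ⊗ M`. -/
def posOpFun (b : P) : Module.End R (ExteriorTensor R V M) :=
  extend (-1) 0 (evenOp V ρ ∘ₗ B b) fun c k => by
    simp [evenOp_wedge, hB.apply_lie_self]

theorem posOpFun_of (b : P) (m : M) : posOpFun ρ hB b (of R V M m) = 0 :=
  extend_of ..

theorem posOpFun_wedge (b : P) (c : V) (k : ExteriorTensor R V M) :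
    posOpFun ρ hB b (wedge R V M c k) =
      (-1 : R) • wedge R V M c (posOpFun ρ hB b k) + evenOp V ρ (B b c) k :=
  extend_wedge ..

/-- The action of `𝔤₁` on `Λ(𝔤₋₁) ⊗ M`, which vanishes on `1 ⊗ M`. -/
def posOp : P →ₗ[R] Module.End R (ExteriorTensor R V M) where
  toFun := posOpFun ρ hB
  map_add' b d := end_ext (-1) (fun c => evenOp V ρ (B (b + d) c))
    (fun m => by simp [posOpFun_of]) (fun c k => posOpFun_wedge ρ hB (b + d) c k)
    fun c k => by
      simp only [LinearMap.add_apply, posOpFun_wedge, neg_smul, one_smul, map_add]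
      abel
  map_smul' r b := end_ext (-1) (fun c => evenOp V ρ (B (r • b) c))
    (fun m => by simp [posOpFun_of]) (fun c k => posOpFun_wedge ρ hB (r • b) c k)
    fun c k => by simp [posOpFun_wedge]

theorem posOp_of (b : P) (m : M) : posOp ρ hB b (of R V M m) = 0 :=
  posOpFun_of ρ hB b m

theorem posOp_wedge (b : P) (c : V) (k : ExteriorTensor R V M) :
    posOp ρ hB b (wedge R V M c k) = -wedge R V M c (posOp ρ hB b k) + evenOp V ρ (B b c) k := by
  rw [← neg_one_smul R (wedge R V M c _)]
  exact posOpFun_wedge ρ hB b c k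

theorem lie_evenOp_posOp (s : E) (b : P) :
    ⁅evenOp V ρ s, posOp ρ hB b⁆ = posOp ρ hB ⁅s, b⁆ := by
  refine end_ext (-1) (fun c => evenOp V ρ (B ⁅s, b⁆ c)) (fun m => ?_) (fun c k => ?_) fun c k => ?_
  · simp [LieRing.of_associative_ring_bracket, evenOp_of, posOp_of]
  · rw [eq_sub_of_add_eq (hB.lie_apply s b c).symm]
    simp only [LieRing.of_associative_ring_bracket, LinearMap.sub_apply, Module.End.mul_apply,
      posOp_wedge, map_add, map_neg, evenOp_wedge, map_sub, neg_smul, one_smul, LieHom.map_lie]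
    abel
  · simp [posOp_wedge]

theorem posOp_mul_posOp_add (b d : P) :
    posOp ρ hB b * posOp ρ hB d + posOp ρ hB d * posOp ρ hB b = 0 := by
  refine end_ext 1 0 (fun m => by simp [posOp_of]) (fun c k => ?_) fun c k => by simp
  have h : posOp ρ hB ⁅B b c, d⁆ k + posOp ρ hB ⁅B d c, b⁆ k = 0 := by
    rw [← LinearMap.add_apply, ← map_add, hB.apply_lie_add, map_zero, LinearMap.zero_apply]
  simp only [← lie_evenOp_posOp, LieRing.of_associative_ring_bracket, LinearMap.sub_apply,
    Module.End.mul_apply] at h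
  simp only [LinearMap.add_apply, Module.End.mul_apply, posOp_wedge, map_add, map_neg, one_smul,
    Pi.zero_apply, add_zero]
  linear_combination (norm := module) (-1 : R) • h

/-- The action of `𝔤₁ ⊕ 𝔤₋₁` on `Λ(𝔤₋₁) ⊗ M`. -/
def oddOp : P × V →ₗ[R] Module.End R (ExteriorTensor R V M) :=
  (posOp ρ hB).coprod (wedge R V M)

theorem oddOp_apply (z : P × V) : oddOp ρ hB z = posOp ρ hB z.1 + wedge R V M z.2 :=
  LinearMap.coprod_apply ..

theorem evenOp_mul_oddOp_sub (s : E) (z : P × V) :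
    evenOp V ρ s * oddOp ρ hB z - oddOp ρ hB z * evenOp V ρ s =
      oddOp ρ hB (⁅s, z.1⁆, ⁅s, z.2⁆) := by
  have hpos := lie_evenOp_posOp ρ hB s z.1
  have hneg : evenOp V ρ s * wedge R V M z.2 - wedge R V M z.2 * evenOp V ρ s =
      wedge R V M ⁅s, z.2⁆ :=
    LinearMap.ext fun k => sub_eq_of_eq_add' (evenOp_wedge ρ s z.2 k)
  rw [LieRing.of_associative_ring_bracket] at hpos
  rw [oddOp_apply, oddOp_apply, ← hpos, ← hneg]
  noncomm_ring

theorem oddOp_mul_oddOp_add (z w : P × V) :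
    oddOp ρ hB z * oddOp ρ hB w + oddOp ρ hB w * oddOp ρ hB z =
      evenOp V ρ (B z.1 w.2 + B w.1 z.2) := by
  have hpos_neg (b : P) (c : V) : posOp ρ hB b * wedge R V M c =
      -(wedge R V M c * posOp ρ hB b) + evenOp V ρ (B b c) :=
    LinearMap.ext fun k => posOp_wedge ρ hB b c k
  have hneg : wedge R V M z.2 * wedge R V M w.2 + wedge R V M w.2 * wedge R V M z.2 = 0 :=
    LinearMap.ext fun k => wedge_wedge_add_wedge_wedge z.2 w.2 k
  have hpos := posOp_mul_posOp_add ρ hB z.1 w.1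
  rw [map_add, ← sub_eq_iff_eq_add'.2 (hpos_neg z.1 w.2), ← sub_eq_iff_eq_add'.2 (hpos_neg w.1 z.2)]
  linear_combination (norm := (simp only [oddOp_apply]; noncomm_ring)) hpos + hneg

end ExteriorTensor

/-- Linear maps to an algebra all of whose values square to zero, such as the action of `𝔤₋₁` on a
`𝔤`-module. -/
def IsSquareZero {R V A : Type*} [CommRing R] [AddCommGroup V] [Module R V] [Ring A] [Algebra R A]
    (y : V →ₗ[R] A) : Prop :=
  ∀ c, y c * y c = 0

namespace IsSquareZero

variable {R V A : Type*} [CommRing R] [AddCommGroup V] [Module R V] [Ring A] [Algebra R A]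
  {y : V →ₗ[R] A} (hy : IsSquareZero y)

include hy

theorem mul_eq_neg_mul (c d : V) : y c * y d = -(y d * y c) := by
  have h := hy (c + d)
  rw [map_add, add_mul, mul_add, mul_add, hy c, hy d, zero_add, add_zero] at h
  exact eq_neg_of_add_eq_zero_left h

theorem mul_prod_map_eq_zero {c : V} {L : List V} (hc : c ∈ L) : y c * (L.map y).prod = 0 := by
  induction L with
  | nil => simp at hc
  | cons d L ih =>
    rw [List.map_cons, List.prod_cons, ← mul_assoc]
    rcases List.mem_cons.1 hc with rfl | hc
    · rw [hy, zero_mul]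
    · rw [hy.mul_eq_neg_mul, neg_mul, mul_assoc, ih hc, mul_zero, neg_zero]

theorem prod_map_mul_eq_neg_one_pow_mul (L : List V) (c : V) :
    (L.map y).prod * y c = (-1) ^ L.length * (y c * (L.map y).prod) := by
  induction L with
  | nil => simp
  | cons d L ih =>
    rw [List.map_cons, List.prod_cons, mul_assoc, ih, ← mul_assoc (y c), hy.mul_eq_neg_mul c d,
      ((Commute.neg_one_left (y d)).pow_left _).symm.left_comm, List.length_cons, pow_succ,
      mul_assoc _ (-1), neg_one_mul, neg_mul, neg_neg, mul_assoc]

theorem prod_map_mul_eq_zero {c : V} {L : List V} (hc : c ∈ L) : (L.map y).prod * y c = 0 := by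
  rw [hy.prod_map_mul_eq_neg_one_pow_mul, hy.mul_prod_map_eq_zero hc, mul_zero]

theorem prod_map_mul_apply_mul_prod_map_mem_span {L₁ L₂ : List V} {d z : V}
    (hz : z ∈ Submodule.span R {c | c ∈ L₁ ++ d :: L₂}) :
    (L₁.map y).prod * y z * (L₂.map y).prod ∈
      Submodule.span R {((L₁ ++ d :: L₂).map y).prod} := by
  induction hz using Submodule.span_induction with
  | zero => simp
  | add u w _ _ hu hw => rw [map_add, mul_add, add_mul]; exact add_mem hu hw
  | smul r u _ hu =>
    rw [map_smul, mul_smul_comm, smul_mul_assoc]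
    exact Submodule.smul_mem _ r hu
  | mem c hc =>
    rcases List.mem_append.1 hc with hc | hc
    · simp [hy.prod_map_mul_eq_zero hc]
    rcases List.mem_cons.1 hc with rfl | hc
    · exact Submodule.subset_span (by simp [mul_assoc])
    · simp [mul_assoc, hy.mul_prod_map_eq_zero hc]

theorem exists_mul_prod_map_eq {a : A} {D : V → V} (ha : ∀ c, a * y c = y c * a + y (D c))
    {L : List V} (hL : Submodule.span R {c | c ∈ L} = ⊤) :
    ∃ r : R, a * (L.map y).prod = (L.map y).prod * a + r • (L.map y).prod := by
  suffices h : ∀ L₁ L₂, L₁ ++ L₂ = L →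
      (L₁.map y).prod * (a * (L₂.map y).prod - (L₂.map y).prod * a) ∈
        Submodule.span R {(L.map y).prod} by
    obtain ⟨r, hr⟩ := Submodule.mem_span_singleton.1 (h [] L rfl)
    rw [List.map_nil, List.prod_nil, one_mul] at hr
    exact ⟨r, by rw [hr, add_sub_cancel]⟩
  intro L₁ L₂ hL₁₂
  induction L₂ generalizing L₁ with
  | nil => simp
  | cons d L₂ ih =>
    have hd := hy.prod_map_mul_apply_mul_prod_map_mem_span (L₁ := L₁) (L₂ := L₂) (d := d)
      (z := D d) (by rw [hL₁₂, hL]; trivial)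
    rw [hL₁₂] at hd
    convert add_mem hd (ih (L₁ ++ [d]) (by simpa using hL₁₂)) using 1
    rw [← sub_eq_iff_eq_add'.2 (ha d)]
    simp only [List.map_cons, List.map_append, List.map_nil, List.prod_append, List.prod_cons,
      List.prod_nil]
    noncomm_ring

end IsSquareZero

section WordSpan

variable {R V A K : Type*} [CommRing R] [AddCommGroup V] [Module R V] [Ring A] [Algebra R A]
  [AddCommGroup K] [Module R K] [Module A K] [IsScalarTower R A K]
  (y : V →ₗ[R] A) (W : Submodule R K)

/-- The sum of the subspaces `y c₁ ⋯ y cₖ • W` over the sublists `[c₁, …, cₖ]` of `L`. -/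
def wordSpan : List V → Submodule R K
  | [] => W
  | c :: L => wordSpan L ⊔ (wordSpan L).map (Algebra.lsmul R R K (y c))

theorem le_wordSpan (L : List V) : W ≤ wordSpan y W L := by
  induction L with
  | nil => exact le_rfl
  | cons c L ih => exact ih.trans le_sup_left

variable {y W}

theorem wordSpan_le {N : Submodule R K} (hWN : W ≤ N) (hN : ∀ c, ∀ w ∈ N, y c • w ∈ N)
    (L : List V) : wordSpan y W L ≤ N := by
  induction L with
  | nil => exact hWN
  | cons c L ih => exact sup_le ih (Submodule.map_le_iff_le_comap.2 fun w hw => hN c w (ih hw))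

theorem IsSquareZero.smul_mem_wordSpan_of_mem (hy : IsSquareZero y) {c : V} {L : List V}
    (hc : c ∈ L) {w : K} (hw : w ∈ wordSpan y W L) : y c • w ∈ wordSpan y W L := by
  induction L generalizing w with
  | nil => simp at hc
  | cons d L ih =>
    obtain ⟨u, hu, _, ⟨t, ht, rfl⟩, rfl⟩ := Submodule.mem_sup.1 hw
    simp only [Algebra.lsmul_coe, smul_add]
    rcases List.mem_cons.1 hc with rfl | hc
    · rw [← mul_smul, hy, zero_smul, add_zero]
      exact Submodule.mem_sup_right ⟨u, hu, rfl⟩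
    · rw [← mul_smul, hy.mul_eq_neg_mul, neg_smul, mul_smul]
      exact add_mem (Submodule.mem_sup_left (ih hc hu))
        (Submodule.mem_sup_right (neg_mem ⟨_, ih hc ht, rfl⟩))

theorem IsSquareZero.smul_mem_wordSpan (hy : IsSquareZero y) {L : List V}
    (hL : Submodule.span R {c | c ∈ L} = ⊤) (c : V) {w : K} (hw : w ∈ wordSpan y W L) :
    y c • w ∈ wordSpan y W L := by
  have hle : Submodule.span R {c | c ∈ L} ≤ (wordSpan y W L).comap
      (((Algebra.lsmul R R K).toLinearMap ∘ₗ y).flip w) :=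
    Submodule.span_le.2 fun d hd => hy.smul_mem_wordSpan_of_mem hd hw
  exact hle (hL ▸ Submodule.mem_top)

theorem smul_mem_wordSpan_of_forall_smul_mem {L : List V}
    (hL : ∀ c, ∀ w ∈ wordSpan y W L, y c • w ∈ wordSpan y W L) {t : A}
    (hW : ∀ w ∈ W, t • w ∈ wordSpan y W L)
    (ht : ∀ c, ∀ w ∈ wordSpan y W L, t • w ∈ wordSpan y W L → t • y c • w ∈ wordSpan y W L)
    {w : K} (hw : w ∈ wordSpan y W L) : t • w ∈ wordSpan y W L := by
  have hle : wordSpan y W L ≤ wordSpan y W L ⊓ (wordSpan y W L).comap (Algebra.lsmul R R K t) :=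
    wordSpan_le (fun w hw => Submodule.mem_inf.2 ⟨le_wordSpan y W L hw, hW w hw⟩)
      (fun c w hw => Submodule.mem_inf.2 ⟨hL c w hw.1, ht c w hw.1 hw.2⟩) L
  exact (hle hw).2

theorem IsSquareZero.exists_prod_map_smul_mem (hy : IsSquareZero y) {L : List V}
    {N : Submodule R K} (hN : ∀ c, ∀ w ∈ N, y c • w ∈ N) {w : K} (hw : w ≠ 0) (hwN : w ∈ N)
    (hwL : w ∈ wordSpan y W L) : ∃ u ∈ W, u ≠ 0 ∧ (L.map y).prod • u ∈ N := by
  induction L generalizing N w with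
  | nil => exact ⟨w, hwL, hw, by simpa using hwN⟩
  | cons c L ih =>
    have hcomap (d : V) (u : K) (hu : y c • u ∈ N) : y c • y d • u ∈ N := by
      rw [← mul_smul, hy.mul_eq_neg_mul, neg_smul, mul_smul]
      exact neg_mem (hN d _ hu)
    suffices h : ∃ t, y c • t ∈ N ∧ t ≠ 0 ∧ t ∈ wordSpan y W L by
      obtain ⟨t, htN, ht, htL⟩ := h
      obtain ⟨u, hu, hu0, huN⟩ := ih (N := N.comap (Algebra.lsmul R R K (y c))) hcomap ht htN htL
      exact ⟨u, hu, hu0, by rwa [List.map_cons, List.prod_cons, mul_smul]⟩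
    obtain ⟨u, hu, _, ⟨t, ht, rfl⟩, rfl⟩ := Submodule.mem_sup.1 hwL
    simp only [Algebra.lsmul_coe] at hw hwN
    by_cases hu0 : u = 0
    · rw [hu0, zero_add] at hw hwN
      exact ⟨t, hwN, right_ne_zero_of_smul hw, ht⟩
    · have h := hN c _ hwN
      rw [smul_add, ← mul_smul, hy, zero_smul, add_zero] at h
      exact ⟨u, h, hu0, hu⟩

end WordSpan

theorem smul_mem_of_adjoin_eq_top {R A K : Type*} [CommSemiring R] [Semiring A] [Algebra R A]
    [AddCommMonoid K] [Module R K] [Module A K] [IsScalarTower R A K] {s : Set A}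
    (hs : Algebra.adjoin R s = ⊤) {W : Submodule R K} (hW : ∀ t ∈ s, ∀ w ∈ W, t • w ∈ W) (u : A)
    {w : K} (hw : w ∈ W) : u • w ∈ W := by
  have hu : u ∈ Algebra.adjoin R s := hs ▸ Algebra.mem_top
  induction hu using Algebra.adjoin_induction generalizing w with
  | mem t ht => exact hW t ht w hw
  | algebraMap r => rw [algebraMap_smul]; exact W.smul_mem r hw
  | add t u _ _ ht hu => rw [add_smul]; exact add_mem (ht hw) (hu hw)
  | mul t u _ _ ht hu => rw [mul_smul]; exact ht (hu hw)

/-- The commutation relations between `𝔤₋₁` and the rest of a `ℤ`-graded Lie superalgebra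
`𝔤 = 𝔤₋₁ ⊕ 𝔤₀ ⊕ 𝔤₁`, for an action of `𝔤` given by linear maps `a` on `E = 𝔤₀`, `x` on `P = 𝔤₁` and
`y` on `V = 𝔤₋₁`. -/
structure GradedRelations {R E V P A : Type*} [CommRing R] [LieRing E] [LieAlgebra R E]
    [AddCommGroup V] [Module R V] [LieRingModule E V] [AddCommGroup P] [Module R P] [Ring A]
    [Algebra R A] (B : P →ₗ[R] V →ₗ[R] E) (a : E →ₗ[R] A) (x : P →ₗ[R] A) (y : V →ₗ[R] A) :
    Prop where
  a_mul_y (s : E) (c : V) : a s * y c = y c * a s + y ⁅s, c⁆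
  x_mul_y (b : P) (c : V) : x b * y c = -(y c * x b) + a (B b c)
  isSquareZero : IsSquareZero y

namespace GradedRelations

variable {R E V P A M K : Type*} [CommRing R] [LieRing E] [LieAlgebra R E]
  [AddCommGroup V] [Module R V] [LieRingModule E V] [AddCommGroup P] [Module R P] [Ring A]
  [Algebra R A] {B : P →ₗ[R] V →ₗ[R] E} {a : E →ₗ[R] A} {x : P →ₗ[R] A} {y : V →ₗ[R] A}
  (h : GradedRelations B a x y) [AddCommGroup K] [Module R K] [Module A K] [IsScalarTower R A K]

include h

theorem wordSpan_eq_top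
    (hA : Algebra.adjoin R (Set.range a ∪ Set.range x ∪ Set.range y) = ⊤) {W : Submodule R K}
    (ha : ∀ s, ∀ w ∈ W, a s • w ∈ W) (hx : ∀ b, ∀ w ∈ W, x b • w = 0)
    (hW : Submodule.span A (W : Set K) = ⊤) {L : List V}
    (hL : Submodule.span R {c | c ∈ L} = ⊤) : wordSpan y W L = ⊤ := by
  have hyL (c : V) (w : K) (hw : w ∈ wordSpan y W L) : y c • w ∈ wordSpan y W L :=
    h.isSquareZero.smul_mem_wordSpan hL c hw
  have haL (s : E) (w : K) (hw : w ∈ wordSpan y W L) : a s • w ∈ wordSpan y W L := by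
    refine smul_mem_wordSpan_of_forall_smul_mem hyL
      (fun w hw => le_wordSpan y W L (ha s w hw)) (fun c w hw hsw => ?_) hw
    rw [← mul_smul, h.a_mul_y, add_smul, mul_smul]
    exact add_mem (hyL c _ hsw) (hyL _ w hw)
  have hxL (b : P) (w : K) (hw : w ∈ wordSpan y W L) : x b • w ∈ wordSpan y W L := by
    refine smul_mem_wordSpan_of_forall_smul_mem hyL
      (fun w hw => hx b w hw ▸ zero_mem _) (fun c w hw hbw => ?_) hw
    rw [← mul_smul, h.x_mul_y, add_smul, neg_smul, mul_smul]
    exact add_mem (neg_mem (hyL c _ hbw)) (haL _ w hw)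
  have hAL (u : A) (w : K) (hw : w ∈ wordSpan y W L) : u • w ∈ wordSpan y W L := by
    refine smul_mem_of_adjoin_eq_top hA ?_ u hw
    rintro _ ((⟨s, rfl⟩ | ⟨b, rfl⟩) | ⟨c, rfl⟩)
    exacts [haL s, hxL b, hyL c]
  refine Submodule.eq_top_iff'.2 fun k => ?_
  have hk : k ∈ Submodule.span A (W : Set K) := hW ▸ Submodule.mem_top
  induction hk using Submodule.span_induction with
  | mem w hw => exact le_wordSpan y W L hw
  | zero => exact zero_mem _
  | add k l _ _ hk hl => exact add_mem hk hl
  | smul u k _ hk => exact hAL u k hk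

theorem prod_map_smul_mem
    (hA : Algebra.adjoin R (Set.range a ∪ Set.range x ∪ Set.range y) = ⊤)
    [AddCommGroup M] [Module R M] {ρ : E → Module.End R M}
    (hρ : ∀ S : Submodule R M, (∀ s, ∀ m ∈ S, ρ s m ∈ S) → S = ⊥ ∨ S = ⊤) {j : M →ₗ[R] K}
    (ha : ∀ s m, a s • j m = j (ρ s m)) (hx : ∀ b m, x b • j m = 0)
    (hj : Submodule.span A (Set.range j) = ⊤) {L : List V}
    (hL : Submodule.span R {c | c ∈ L} = ⊤) {N : Submodule A K} (hN : N ≠ ⊥) (m : M) :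
    (L.map y).prod • j m ∈ N := by
  obtain ⟨w, hwN, hw0⟩ := Submodule.exists_mem_ne_zero_of_ne_bot hN
  have hwL : w ∈ wordSpan y (LinearMap.range j) L := by
    rw [h.wordSpan_eq_top hA (W := LinearMap.range j) _ _ (by rwa [LinearMap.coe_range]) hL]
    · trivial
    · rintro s _ ⟨m, rfl⟩
      exact ⟨_, (ha s m).symm⟩
    · rintro b _ ⟨m, rfl⟩
      exact hx b m
  obtain ⟨_, ⟨m₀, rfl⟩, hm₀, hm₀N⟩ := h.isSquareZero.exists_prod_map_smul_mem
    (N := N.restrictScalars R) (fun c w hw => N.smul_mem (y c) hw) hw0 hwN hwL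
  let S : Submodule R M :=
    (N.restrictScalars R).comap (Algebra.lsmul R R K (L.map y).prod ∘ₗ j)
  have hS (s : E) (m : M) (hm : m ∈ S) : ρ s m ∈ S := by
    change (L.map y).prod • j (ρ s m) ∈ N
    obtain ⟨r, hr⟩ := h.isSquareZero.exists_mul_prod_map_eq (h.a_mul_y s) hL
    rw [← ha, ← mul_smul, eq_sub_of_add_eq hr.symm, sub_smul, mul_smul, smul_assoc]
    exact sub_mem (N.smul_mem _ hm) (N.smul_of_tower_mem r hm)
  have hS0 : S ≠ ⊥ := fun hS0 => hm₀ <| by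
    rw [(Submodule.mem_bot R).1 (hS0 ▸ hm₀N : m₀ ∈ (⊥ : Submodule R M)), map_zero]
  exact ((hρ S hS).resolve_left hS0 ▸ Submodule.mem_top : m ∈ S)

end GradedRelations

namespace Periplectic

open Matrix

section MatrixModules

variable (R m : Type*) [CommRing R]

/-- The skew-symmetric matrices, identified with `𝔤₋₁`. -/
def skew : Submodule R (Matrix m m R) where
  carrier := {c | cᵀ = -c}
  add_mem' {c d} (hc : cᵀ = -c) (hd : dᵀ = -d) := by
    rw [Set.mem_ofPred_eq, transpose_add, hc, hd, neg_add]
  zero_mem' := by simp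
  smul_mem' r c (hc : cᵀ = -c) := by rw [Set.mem_ofPred_eq, transpose_smul, hc, smul_neg]

/-- The symmetric matrices, identified with `𝔤₁`. -/
def symm : Submodule R (Matrix m m R) where
  carrier := {b | bᵀ = b}
  add_mem' {b d} (hb : bᵀ = b) (hd : dᵀ = d) := by
    rw [Set.mem_ofPred_eq, transpose_add, hb, hd]
  zero_mem' := transpose_zero
  smul_mem' r b (hb : bᵀ = b) := by rw [Set.mem_ofPred_eq, transpose_smul, hb]

variable {R m}

theorem transpose_coe_skew (c : skew R m) : (c : Matrix m m R)ᵀ = -c := c.2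

theorem transpose_coe_symm (b : symm R m) : (b : Matrix m m R)ᵀ = b := b.2

variable [Fintype m] [DecidableEq m]

instance : LieRingModule (Matrix m m R) (skew R m) where
  bracket s c := ⟨-(sᵀ * c) - c * s, by
    change _ᵀ = _
    simp only [transpose_sub, transpose_neg, transpose_mul, transpose_transpose,
      transpose_coe_skew]
    noncomm_ring⟩
  add_lie s t c := Subtype.ext <| by
    change -((s + t)ᵀ * (c : Matrix m m R)) - c * (s + t) =
      (-(sᵀ * (c : Matrix m m R)) - c * s) + (-(tᵀ * (c : Matrix m m R)) - c * t)
    rw [transpose_add]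
    noncomm_ring
  lie_add s c d := Subtype.ext <| by
    change -(sᵀ * ((c : Matrix m m R) + d)) - (c + d) * s =
      (-(sᵀ * (c : Matrix m m R)) - c * s) + (-(sᵀ * (d : Matrix m m R)) - d * s)
    noncomm_ring
  leibniz_lie s t c := Subtype.ext <| by
    change -(sᵀ * (-(tᵀ * (c : Matrix m m R)) - c * t)) - (-(tᵀ * (c : Matrix m m R)) - c * t) * s =
      (-((s * t - t * s)ᵀ * (c : Matrix m m R)) - c * (s * t - t * s)) +
        (-(tᵀ * (-(sᵀ * (c : Matrix m m R)) - c * s)) - (-(sᵀ * (c : Matrix m m R)) - c * s) * t)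
    rw [transpose_sub, transpose_mul, transpose_mul]
    noncomm_ring

theorem coe_lie_skew (s : Matrix m m R) (c : skew R m) :
    (⁅s, c⁆ : skew R m) = -(sᵀ * (c : Matrix m m R)) - c * s := rfl

instance : LieModule R (Matrix m m R) (skew R m) where
  smul_lie r s c := Subtype.ext <| by simp [coe_lie_skew, smul_sub]
  lie_smul r s c := Subtype.ext <| by simp [coe_lie_skew, smul_sub]

instance : LieRingModule (Matrix m m R) (symm R m) where
  bracket s b := ⟨s * b + b * sᵀ, by
    change _ᵀ = _
    simp only [transpose_add, transpose_mul, transpose_transpose, transpose_coe_symm]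
    exact add_comm _ _⟩
  add_lie s t b := Subtype.ext <| by
    change (s + t) * (b : Matrix m m R) + b * (s + t)ᵀ =
      (s * (b : Matrix m m R) + b * sᵀ) + (t * (b : Matrix m m R) + b * tᵀ)
    rw [transpose_add]
    noncomm_ring
  lie_add s b d := Subtype.ext <| by
    change s * ((b : Matrix m m R) + d) + (b + d) * sᵀ =
      (s * (b : Matrix m m R) + b * sᵀ) + (s * (d : Matrix m m R) + d * sᵀ)
    noncomm_ring
  leibniz_lie s t b := Subtype.ext <| by
    change s * (t * (b : Matrix m m R) + b * tᵀ) + (t * (b : Matrix m m R) + b * tᵀ) * sᵀ =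
      ((s * t - t * s) * (b : Matrix m m R) + b * (s * t - t * s)ᵀ) +
        (t * (s * (b : Matrix m m R) + b * sᵀ) + (s * (b : Matrix m m R) + b * sᵀ) * tᵀ)
    rw [transpose_sub, transpose_mul, transpose_mul]
    noncomm_ring

theorem coe_lie_symm (s : Matrix m m R) (b : symm R m) :
    (⁅s, b⁆ : symm R m) = s * (b : Matrix m m R) + b * sᵀ := rfl

variable (R m) in
/-- The bracket `𝔤₁ × 𝔤₋₁ → 𝔤₀` of `𝔭(n)`. -/
def bracket : symm R m →ₗ[R] skew R m →ₗ[R] Matrix m m R :=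
  (LinearMap.mul R (Matrix m m R)).domRestrict₁₂ (symm R m) (skew R m)

theorem bracket_apply (b : symm R m) (c : skew R m) :
    bracket R m b c = (b : Matrix m m R) * c := rfl

theorem isGradedBracket_bracket : IsGradedBracket (bracket R m) where
  lie_apply s b c := by
    simp only [bracket_apply, coe_lie_symm, coe_lie_skew, LieRing.of_associative_ring_bracket]
    noncomm_ring
  apply_lie_self b c := Subtype.ext <| by
    simp [coe_lie_skew, bracket_apply, transpose_coe_skew, transpose_coe_symm, mul_assoc]
  apply_lie_add b d c := Subtype.ext <| by
    simp [coe_lie_symm, bracket_apply, transpose_coe_skew, transpose_coe_symm, mul_assoc]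

theorem toEnd_skew_pow_char (p : ℕ) [Fact p.Prime] [CharP R p] (s : Matrix m m R) :
    LieModule.toEnd R (Matrix m m R) (skew R m) s ^ p =
      LieModule.toEnd R (Matrix m m R) (skew R m) (s ^ p) := by
  refine LinearMap.ext fun c => Subtype.ext ?_
  have h := pow_char_mul_sub_mul_pow_char (p := p) (a := -sᵀ) (b := s) (T := (skew R m).subtype)
    (D := LieModule.toEnd R (Matrix m m R) (skew R m) s)
    (fun c => by rw [neg_mul]; exact (coe_lie_skew s c).symm) c
  rw [neg_pow_char_of_algebra R p, ← transpose_pow, neg_mul] at h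
  exact h.symm

end MatrixModules

section MatrixUnits

variable (R : Type*) {m : Type*} [CommRing R] [DecidableEq m]

/-- The skew-symmetric matrix `e_{ij} - e_{ji}`. -/
def skewUnit (i j : m) : skew R m :=
  ⟨single i j 1 - single j i 1, by change _ᵀ = _; simp⟩

/-- The symmetric matrix `e_{ij} + e_{ji}`. -/
def symmUnit (i j : m) : symm R m :=
  ⟨single i j 1 + single j i 1, by change _ᵀ = _; simp [add_comm]⟩

theorem skewUnit_self (i : m) : skewUnit R i i = 0 := Subtype.ext (sub_self _)

theorem skewUnit_swap (i j : m) : skewUnit R j i = -skewUnit R i j :=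
  Subtype.ext (neg_sub _ _).symm

variable {R} [Fintype m]

theorem single_one_mul_single_one (i j k l : m) :
    (single i j 1 * single k l 1 : Matrix m m R) = if j = k then single i l 1 else 0 := by
  split_ifs with h
  · rw [h, single_mul_single_same, one_mul]
  · rw [single_mul_single_of_ne _ _ _ _ h]

theorem lie_single_skewUnit (i j k l : m) :
    ⁅(single i j 1 : Matrix m m R), skewUnit R k l⁆ =
      -(if i = k then skewUnit R j l else 0) - if i = l then skewUnit R k j else 0 := by
  ext1
  simp only [coe_lie_skew, AddSubgroupClass.coe_sub, NegMemClass.coe_neg, apply_ite Subtype.val,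
    ZeroMemClass.coe_zero, skewUnit, transpose_single, mul_sub, sub_mul,
    single_one_mul_single_one, eq_comm (a := l) (b := i), eq_comm (a := k) (b := i)]
  split_ifs <;> abel

theorem lie_single_self_skewUnit (i k l : m) :
    ⁅(single i i 1 : Matrix m m R), skewUnit R k l⁆ =
      -(((if k = i then (1 : R) else 0) + if l = i then 1 else 0) • skewUnit R k l) := by
  rw [lie_single_skewUnit]
  rcases eq_or_ne i k with rfl | hk <;> rcases eq_or_ne i l with rfl | hl
  · simp [skewUnit_self]
  · simp [hl, hl.symm]
  · simp [hk, hk.symm]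
  · simp [hk, hk.symm, hl, hl.symm]

theorem symmUnit_mul_skewUnit (i j k l : m) :
    (symmUnit R i j : Matrix m m R) * (skewUnit R k l : Matrix m m R) =
      (if j = k then single i l 1 else 0) - (if j = l then single i k 1 else 0) +
        (if i = k then single j l 1 else 0) - if i = l then single j k 1 else 0 := by
  simp only [symmUnit, skewUnit, mul_sub, add_mul, single_one_mul_single_one]
  abel

theorem two_smul_eq_sum_skewUnit (c : skew R m) :
    (2 : R) • c = ∑ i, ∑ j, (c : Matrix m m R) i j • skewUnit R i j := by
  have hsum (d : Matrix m m R) : ∑ i, ∑ j, d i j • (single i j 1 : Matrix m m R) = d := by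
    conv_rhs => rw [matrix_eq_sum_single d]
    simp
  have hswap : ∑ i, ∑ j, (c : Matrix m m R) i j • (single j i 1 : Matrix m m R) = -c := by
    rw [Finset.sum_comm, ← transpose_coe_skew]
    exact hsum (c : Matrix m m R)ᵀ
  ext1
  simp only [Submodule.coe_smul, Submodule.coe_add, Submodule.coe_sum, skewUnit, smul_sub,
    Finset.sum_sub_distrib, hsum, hswap, sub_neg_eq_add, two_smul]

omit [Fintype m] in
theorem span_skewUnit_eq_top [Finite m] [LinearOrder m] (h2 : IsUnit (2 : R)) :
    Submodule.span R {c | ∃ i j : m, i < j ∧ skewUnit R i j = c} = ⊤ := by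
  cases nonempty_fintype m
  set S := Submodule.span R {c | ∃ i j : m, i < j ∧ skewUnit R i j = c}
  have hunit (i j : m) : skewUnit R i j ∈ S := by
    rcases lt_trichotomy i j with h | rfl | h
    · exact Submodule.subset_span ⟨i, j, h, rfl⟩
    · rw [skewUnit_self]; exact zero_mem _
    · rw [skewUnit_swap]; exact neg_mem (Submodule.subset_span ⟨j, i, h, rfl⟩)
  refine Submodule.eq_top_iff'.2 fun c => ?_
  rw [← Submodule.smul_mem_iff_of_isUnit S h2, two_smul_eq_sum_skewUnit]
  exact sum_mem fun i _ => sum_mem fun j _ => S.smul_mem _ (hunit i j)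

end MatrixUnits

section Roots

variable {n : ℕ}

/-- `L` lists, in lexicographic order, the members of an upper set of the pairs `i < j`; the pair
`(i, j)` stands for the root `-ε_i - ε_j` of `𝔤₋₁`. -/
structure IsFinalSegment (L : List (Fin n × Fin n)) : Prop where
  pairwise : L.Pairwise fun P Q => toLex P < toLex Q
  lt : ∀ P ∈ L, P.1 < P.2
  mem_of_lt : ∀ P ∈ L, ∀ Q : Fin n × Fin n, Q.1 < Q.2 → toLex P < toLex Q → Q ∈ L

namespace IsFinalSegment

variable {P : Fin n × Fin n} {L : List (Fin n × Fin n)}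

theorem mem_tail_iff (h : IsFinalSegment (P :: L)) (Q : Fin n × Fin n) :
    Q ∈ L ↔ Q.1 < Q.2 ∧ toLex P < toLex Q := by
  refine ⟨fun hQ => ⟨h.lt Q (List.mem_cons_of_mem _ hQ), List.rel_of_pairwise_cons h.pairwise hQ⟩,
    fun hQ => (List.mem_cons.1 (h.mem_of_lt P List.mem_cons_self Q hQ.1 hQ.2)).resolve_left ?_⟩
  rintro rfl
  exact hQ.2.false

theorem tail (h : IsFinalSegment (P :: L)) : IsFinalSegment L where
  pairwise := h.pairwise.of_cons
  lt Q hQ := h.lt Q (List.mem_cons_of_mem _ hQ)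
  mem_of_lt P' hP' Q hQ hPQ := (h.mem_tail_iff Q).2 ⟨hQ, ((h.mem_tail_iff P').1 hP').2.trans hPQ⟩

theorem nodup (h : IsFinalSegment L) : L.Nodup :=
  h.pairwise.imp fun h => mt (congrArg toLex) h.ne

end IsFinalSegment

variable (n) in
theorem exists_isFinalSegment :
    ∃ L : List (Fin n × Fin n), IsFinalSegment L ∧ ∀ P, P ∈ L ↔ P.1 < P.2 := by
  let S : Finset (Fin n ×ₗ Fin n) := {P | (ofLex P).1 < (ofLex P).2}
  have hL (P : Fin n × Fin n) : P ∈ S.sort.map ofLex ↔ P.1 < P.2 := by simp [S]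
  refine ⟨S.sort.map ofLex, ⟨?_, fun P hP => (hL P).1 hP, fun _ _ Q hQ _ => (hL Q).2 hQ⟩, hL⟩
  exact List.pairwise_map.2 (Finset.sortedLT_sort S).pairwise

theorem count_map_eq_card {α β γ : Type*} [DecidableEq β] {L : List α} (hL : L.Nodup) {f : α → β}
    {x : β} (S : Finset γ) (g : γ ↪ α) (h : ∀ a, a ∈ L ∧ f a = x ↔ a ∈ S.map g) :
    (L.map f).count x = S.card := by
  classical
  rw [List.count, List.countP_map, List.countP_eq_length_filter,
    ← List.toFinset_card_of_nodup (hL.filter _), ← Finset.card_map g]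
  congr 1
  ext a
  simp [← h]

/-- The number of pairs in `L` that contain `i`. -/
def degree (L : List (Fin n × Fin n)) (i : Fin n) : ℕ :=
  (L.map Prod.fst).count i + (L.map Prod.snd).count i

theorem degree_cons (P : Fin n × Fin n) (L : List (Fin n × Fin n)) (i : Fin n) :
    degree (P :: L) i = degree L i + ((if P.1 = i then 1 else 0) + if P.2 = i then 1 else 0) := by
  simp only [degree, List.map_cons, List.count_cons, beq_iff_eq]
  ring

namespace IsFinalSegment

variable {i j : Fin n} {L : List (Fin n × Fin n)} (h : IsFinalSegment ((i, j) :: L))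
include h

theorem degree_fst : degree L i = (Finset.Ioi j).card := by
  have hij : i < j := h.lt _ List.mem_cons_self
  have hsnd : i ∉ L.map Prod.snd := by
    simp only [List.mem_map, h.mem_tail_iff, Prod.Lex.toLex_lt_toLex]
    rintro ⟨Q, ⟨hQ, hlt⟩, rfl⟩
    omega
  rw [degree, List.count_eq_zero.2 hsnd, add_zero]
  refine count_map_eq_card h.tail.nodup _ (.sectR i _) fun Q => ?_
  obtain ⟨k, l⟩ := Q
  simp only [h.mem_tail_iff, Prod.Lex.toLex_lt_toLex, Finset.mem_map, Finset.mem_Ioi,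
    Function.Embedding.sectR_apply, Prod.mk.injEq, exists_eq_right_right]
  omega

theorem degree_snd : degree L j = (Finset.Ioi j).card + (Finset.Ioo i j).card := by
  have hij : i < j := h.lt _ List.mem_cons_self
  rw [degree]
  congr 1
  · refine count_map_eq_card h.tail.nodup _ (.sectR j _) fun Q => ?_
    obtain ⟨k, l⟩ := Q
    simp only [h.mem_tail_iff, Prod.Lex.toLex_lt_toLex, Finset.mem_map, Finset.mem_Ioi,
      Function.Embedding.sectR_apply, Prod.mk.injEq, exists_eq_right_right]
    omega
  · refine count_map_eq_card h.tail.nodup _ (.sectL _ j) fun Q => ?_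
    obtain ⟨k, l⟩ := Q
    simp only [h.mem_tail_iff, Prod.Lex.toLex_lt_toLex, Finset.mem_map, Finset.mem_Ioo,
      Function.Embedding.sectL_apply, Prod.mk.injEq, ↓existsAndEq, true_and]
    omega

theorem cast_degree_sub (R : Type*) [CommRing R] :
    (degree L j : R) - degree L i = (j : ℕ) - (i : ℕ) - 1 := by
  have hij : (i : ℕ) + 1 ≤ j := h.lt _ List.mem_cons_self
  rw [h.degree_fst, h.degree_snd, Nat.cast_add, add_sub_cancel_left, Fin.card_Ioo, Nat.sub_sub,
    Nat.cast_sub hij, Nat.cast_add, Nat.cast_one, sub_sub]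

end IsFinalSegment

end Roots

section SingularVectors

variable {R A K : Type*} [CommRing R] {n : ℕ} [Ring A] [Algebra R A]

variable (R) in
/-- The root vectors of `𝔤₋₁` for the roots in `L`. -/
def skewUnits (L : List (Fin n × Fin n)) : List (skew R (Fin n)) :=
  L.map fun P => skewUnit R P.1 P.2

theorem skewUnits_cons (P : Fin n × Fin n) (L : List (Fin n × Fin n)) :
    skewUnits R (P :: L) = skewUnit R P.1 P.2 :: skewUnits R L := rfl

theorem span_skewUnits_eq_top (h2 : IsUnit (2 : R)) {L : List (Fin n × Fin n)}
    (hL : ∀ P, P ∈ L ↔ P.1 < P.2) : Submodule.span R {c | c ∈ skewUnits R L} = ⊤ := by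
  rw [← span_skewUnit_eq_top h2]
  congr 1
  ext c
  simp [skewUnits, hL]

/-- The product `∏ y_{ij}` over the roots `(i, j)` in `L`, in the order of `L`. -/
def rootProd (y : skew R (Fin n) →ₗ[R] A) (L : List (Fin n × Fin n)) : A :=
  ((skewUnits R L).map y).prod

theorem rootProd_nil (y : skew R (Fin n) →ₗ[R] A) : rootProd y [] = 1 := rfl

theorem rootProd_cons (y : skew R (Fin n) →ₗ[R] A) (P : Fin n × Fin n)
    (L : List (Fin n × Fin n)) :
    rootProd y (P :: L) = y (skewUnit R P.1 P.2) * rootProd y L := by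
  rw [rootProd, skewUnits_cons, List.map_cons, List.prod_cons, rootProd]

variable {a : Matrix (Fin n) (Fin n) R →ₗ[R] A} {x : symm R (Fin n) →ₗ[R] A}
  {y : skew R (Fin n) →ₗ[R] A} {P : Fin n × Fin n} {L : List (Fin n × Fin n)}

theorem skewUnit_mul_rootProd_eq_zero (hy : IsSquareZero y) (hL : IsFinalSegment (P :: L))
    {k l : Fin n} (hkl : k < l) (hlt : toLex P < toLex (k, l)) :
    y (skewUnit R k l) * rootProd y L = 0 :=
  hy.mul_prod_map_eq_zero (List.mem_map.2 ⟨(k, l), (hL.mem_tail_iff _).2 ⟨hkl, hlt⟩, rfl⟩)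

theorem lie_mul_rootProd_eq_zero (hy : IsSquareZero y) (hL : IsFinalSegment (P :: L))
    {i j : Fin n} (hij : i < j) :
    y ⁅(single i j 1 : Matrix (Fin n) (Fin n) R), skewUnit R P.1 P.2⁆ * rootProd y L = 0 := by
  have hP := hL.lt P List.mem_cons_self
  have hfst (h : i = P.1) : y (skewUnit R j P.2) * rootProd y L = 0 := by
    rcases lt_trichotomy j P.2 with hj | rfl | hj
    · exact skewUnit_mul_rootProd_eq_zero hy hL hj (Prod.Lex.toLex_lt_toLex.2 (.inl (h ▸ hij)))
    · rw [skewUnit_self, map_zero, zero_mul]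
    · rw [skewUnit_swap, map_neg, neg_mul, skewUnit_mul_rootProd_eq_zero hy hL hj
        (Prod.Lex.toLex_lt_toLex.2 (.inl hP)), neg_zero]
  have hsnd (h : i = P.2) : y (skewUnit R P.1 j) * rootProd y L = 0 :=
    skewUnit_mul_rootProd_eq_zero hy hL (hP.trans (h ▸ hij))
      (Prod.Lex.toLex_lt_toLex.2 (.inr ⟨rfl, h ▸ hij⟩))
  rw [lie_single_skewUnit, map_sub, map_neg, sub_mul, neg_mul]
  split_ifs with h₁ h₂ h₂
  · simp [hfst h₁, hsnd h₂]
  · simp [hfst h₁]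
  · simp [hsnd h₂]
  · simp

variable [AddCommGroup K] [Module R K] [Module A K]

/-- `v` is a weight vector of weight `μ` killed by `𝔫₀⁺` and by `𝔤₁`, in a module over an algebra
with maps `a` from `𝔤₀` and `x` from `𝔤₁`. -/
structure IsSingular (a : Matrix (Fin n) (Fin n) R →ₗ[R] A) (x : symm R (Fin n) →ₗ[R] A) (v : K)
    (μ : Fin n → R) : Prop where
  single_smul : ∀ i j, i < j → a (single i j 1) • v = 0
  x_smul : ∀ b, x b • v = 0
  diag_smul : ∀ i, a (single i i 1) • v = μ i • v

namespace IsSingular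

variable {v : K} {μ : Fin n → R} (hv : IsSingular a x v μ)
  (h : GradedRelations (bracket R (Fin n)) a x y)
include hv h

theorem single_smul_rootProd_smul (hL : IsFinalSegment L) {i j : Fin n} (hij : i < j) :
    a (single i j 1) • rootProd y L • v = 0 := by
  induction L with
  | nil => rw [rootProd_nil, one_smul, hv.single_smul i j hij]
  | cons P L ih =>
    rw [rootProd_cons, ← mul_smul, ← mul_assoc, h.a_mul_y, add_mul,
      lie_mul_rootProd_eq_zero h.isSquareZero hL hij, add_zero, mul_assoc, mul_smul, mul_smul,
      ih hL.tail, smul_zero]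

theorem symmUnit_smul_rootProd_smul (hL : IsFinalSegment L) {i j : Fin n} (hij : i < j)
    (hlt : ∀ Q ∈ L, toLex (i, j) < toLex Q) :
    x (symmUnit R i j) • rootProd y L • v = 0 := by
  induction L with
  | nil => rw [rootProd_nil, one_smul, hv.x_smul]
  | cons P L ih =>
    have hP := hL.lt P List.mem_cons_self
    have hlt_P : i < P.1 ∨ i = P.1 ∧ j < P.2 :=
      Prod.Lex.toLex_lt_toLex.1 (hlt P List.mem_cons_self)
    have hpos (q : Prop) [Decidable q] (k l : Fin n) (hkl : q → k < l) :
        a (if q then single k l 1 else 0) • rootProd y L • v = 0 := by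
      split_ifs with hq
      · exact hv.single_smul_rootProd_smul h hL.tail (hkl hq)
      · rw [map_zero, zero_smul]
    rw [rootProd_cons, ← mul_smul, ← mul_assoc, h.x_mul_y, add_mul, add_smul, neg_mul, neg_smul,
      mul_assoc, mul_smul, mul_smul, ih hL.tail fun Q hQ => hlt Q (List.mem_cons_of_mem _ hQ),
      smul_zero, neg_zero, zero_add, bracket_apply, symmUnit_mul_skewUnit, mul_smul, map_sub,
      map_add, map_sub, sub_smul, add_smul, sub_smul, hpos, hpos, hpos, hpos]
    · simp
    all_goals omega

variable [IsScalarTower R A K]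

theorem diag_smul_rootProd_smul (L : List (Fin n × Fin n)) (i : Fin n) :
    a (single i i 1) • rootProd y L • v = (μ i - degree L i) • rootProd y L • v := by
  induction L with
  | nil => simpa [rootProd_nil, degree] using hv.diag_smul i
  | cons P L ih =>
    rw [rootProd_cons, mul_smul, ← mul_smul (a _), h.a_mul_y, add_smul, mul_smul, ih,
      lie_single_self_skewUnit, map_neg, map_smul, neg_smul, smul_assoc,
      ← smul_comm (μ i - _) (y _), ← sub_eq_add_neg,
      ← sub_smul, degree_cons, sub_sub]
    push_cast
    rfl

theorem symmUnit_smul_rootProd_cons_smul {i j : Fin n} (hL : IsFinalSegment ((i, j) :: L)) :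
    x (symmUnit R i j) • rootProd y ((i, j) :: L) • v =
      (-(μ i - μ j + (j : ℕ) - (i : ℕ) - 1)) • rootProd y L • v := by
  have hij : i < j := hL.lt _ List.mem_cons_self
  have hbracket : bracket R (Fin n) (symmUnit R i j) (skewUnit R i j) =
      single j j 1 - single i i 1 := by
    rw [bracket_apply, symmUnit_mul_skewUnit, if_neg hij.ne', if_pos rfl, if_pos rfl, if_neg hij.ne]
    abel
  rw [rootProd_cons, mul_smul, ← mul_smul (x _), h.x_mul_y, add_smul, neg_smul, mul_smul,
    hv.symmUnit_smul_rootProd_smul h hL.tail hij fun Q hQ => ((hL.mem_tail_iff Q).1 hQ).2,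
    smul_zero, neg_zero, zero_add, hbracket, map_sub, sub_smul, hv.diag_smul_rootProd_smul h,
    hv.diag_smul_rootProd_smul h, ← sub_smul]
  congr 1
  linear_combination -hL.cast_degree_sub R

theorem mem_of_rootProd_smul_mem
    (hμ : ∀ i j, i < j → IsUnit (μ i - μ j + ((j : ℕ) : R) - ((i : ℕ) : R) - 1))
    (hL : IsFinalSegment L) {N : Submodule A K} (hN : rootProd y L • v ∈ N) : v ∈ N := by
  induction L with
  | nil => rwa [rootProd_nil, one_smul] at hN
  | cons P L ih =>
    obtain ⟨i, j⟩ := P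
    have hxN := N.smul_mem (x (symmUnit R i j)) hN
    rw [hv.symmUnit_smul_rootProd_cons_smul h hL] at hxN
    exact ih hL.tail (((N.restrictScalars R).smul_mem_iff_of_isUnit
      (hμ i j (hL.lt _ List.mem_cons_self)).neg).1 hxN)

end IsSingular

end SingularVectors

end Periplectic

namespace RestrictedLieSuperalgebra

variable {F A : Type*} [CommRing F] [Ring A] [Algebra F A] {p : ℕ}
  (L : RestrictedLieSuperalgebra F A p) (χ : Module.Dual F L.even)

theorem adjoin_range_ι :
    Algebra.adjoin F (Set.range (L.ι₀ χ) ∪ Set.range (L.ι₁ χ)) = ⊤ := by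
  have hsurj : Function.Surjective ((L.mkRed χ).comp L.mkEnv) :=
    (RingQuot.mkAlgHom_surjective F (L.RedRel χ)).comp (RingQuot.mkAlgHom_surjective F L.EnvRel)
  rw [eq_top_iff, ← (AlgHom.range_eq_top _).2 hsurj, ← Algebra.map_top,
    ← TensorAlgebra.adjoin_range_ι, AlgHom.map_adjoin]
  refine Algebra.adjoin_le ?_
  rintro _ ⟨_, ⟨⟨x, y⟩, rfl⟩, rfl⟩
  have hxy : L.mkRed χ (L.envι (x, y)) = L.ι₀ χ x + L.ι₁ χ y := by
    rw [← Prod.fst_add_snd (x, y), map_add, map_add]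
    rfl
  change L.mkRed χ (L.envι (x, y)) ∈ _
  rw [hxy]
  exact add_mem (Algebra.subset_adjoin (.inl ⟨x, rfl⟩)) (Algebra.subset_adjoin (.inr ⟨y, rfl⟩))

theorem eq_bot_or_eq_top_of_smul_mem {M : Type*} [AddCommGroup M] [Module F M]
    [Module (L.Red χ) M] [IsScalarTower F (L.Red χ) M] (hM : IsSimpleModule (L.Red χ) M)
    (S : Submodule F M) (h₀ : ∀ x, ∀ m ∈ S, L.ι₀ χ x • m ∈ S)
    (h₁ : ∀ x, ∀ m ∈ S, L.ι₁ χ x • m ∈ S) : S = ⊥ ∨ S = ⊤ := by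
  have hstable (t) (ht : t ∈ Set.range (L.ι₀ χ) ∪ Set.range (L.ι₁ χ)) (m) (hm : m ∈ S) :
      t • m ∈ S := by
    rcases ht with ⟨x, rfl⟩ | ⟨x, rfl⟩
    exacts [h₀ x m hm, h₁ x m hm]
  let T : Submodule (L.Red χ) M :=
    { S.toAddSubmonoid with
      smul_mem' := fun u _ hm => smul_mem_of_adjoin_eq_top (L.adjoin_range_ι χ) hstable u hm }
  have hT : T.restrictScalars F = S := rfl
  rw [← hT, Submodule.restrictScalars_eq_bot_iff, Submodule.restrictScalars_eq_top_iff]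
  exact eq_bot_or_eq_top T

end RestrictedLieSuperalgebra

namespace Periplectic

open Matrix RestrictedLieSuperalgebra ExteriorTensor

section Blocks

variable (F : Type*) [Field F] (n : ℕ)

/-- The identification of `gl(n)` with `𝔤₀`, sending `e_{ij}` to `e F i j`. -/
def glEquiv : Matrix (Fin n) (Fin n) F ≃ₗ[F] g₀ F n where
  toFun s := ⟨fromBlocks s 0 0 (-sᵀ), s, rfl⟩
  map_add' s t := Subtype.ext (by simp [fromBlocks_add, add_comm])
  map_smul' r s := Subtype.ext (by simp [fromBlocks_smul])
  invFun x := (x : Mat F n).toBlocks₁₁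
  left_inv _ := rfl
  right_inv := by rintro ⟨_, s, rfl⟩; rfl

/-- The identification of the odd part of `𝔭(n)` with `𝔤₁ × 𝔤₋₁`. -/
def oddEquiv : (symm F (Fin n) × skew F (Fin n)) ≃ₗ[F] gOdd F n where
  toFun z := ⟨fromBlocks 0 z.1 z.2 0, z.1, z.2, z.1.2, z.2.2, rfl⟩
  map_add' z w := Subtype.ext (by simp [fromBlocks_add])
  map_smul' r z := Subtype.ext (by simp [fromBlocks_smul])
  invFun x := (⟨(x : Mat F n).toBlocks₁₂, by obtain ⟨_, b, c, hb, hc, rfl⟩ := x; exact hb⟩,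
    ⟨(x : Mat F n).toBlocks₂₁, by obtain ⟨_, b, c, hb, hc, rfl⟩ := x; exact hc⟩)
  left_inv _ := rfl
  right_inv := by rintro ⟨_, b, c, hb, hc, rfl⟩; rfl

/-- The identification of the symmetric matrices with `𝔤₁`. -/
def posEquiv : symm F (Fin n) ≃ gPos F n where
  toFun b := ⟨fromBlocks 0 b 0 0, b, b.2, rfl⟩
  invFun x := ⟨(x : Mat F n).toBlocks₁₂, by obtain ⟨_, b, hb, rfl⟩ := x; exact hb⟩
  left_inv _ := rfl
  right_inv := by rintro ⟨_, b, hb, rfl⟩; rfl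

variable {F n}

theorem coe_glEquiv (s : Matrix (Fin n) (Fin n) F) :
    (glEquiv F n s : Mat F n) = fromBlocks s 0 0 (-sᵀ) := rfl

theorem coe_oddEquiv (z : symm F (Fin n) × skew F (Fin n)) :
    (oddEquiv F n z : Mat F n) = fromBlocks 0 z.1 z.2 0 := rfl

variable (p : ℕ) [Fact p.Prime] [CharP F p]

theorem lie₀₀_glEquiv (s t : Matrix (Fin n) (Fin n) F) :
    (g F n p).lie₀₀ (glEquiv F n s) (glEquiv F n t) = glEquiv F n ⁅s, t⁆ :=
  Subtype.ext <| by
    simp [lie₀₀, coe_glEquiv, fromBlocks_multiply, sub_eq_add_neg, fromBlocks_neg, fromBlocks_add,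
      LieRing.of_associative_ring_bracket, add_comm]

theorem lie₀₁_glEquiv_oddEquiv (s : Matrix (Fin n) (Fin n) F)
    (z : symm F (Fin n) × skew F (Fin n)) :
    (g F n p).lie₀₁ (glEquiv F n s) (oddEquiv F n z) = oddEquiv F n (⁅s, z.1⁆, ⁅s, z.2⁆) :=
  Subtype.ext <| by
    simp [lie₀₁, coe_glEquiv, coe_oddEquiv, fromBlocks_multiply, sub_eq_add_neg, fromBlocks_neg,
      fromBlocks_add, coe_lie_symm, coe_lie_skew]

theorem lie₁₁_oddEquiv (z w : symm F (Fin n) × skew F (Fin n)) :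
    (g F n p).lie₁₁ (oddEquiv F n z) (oddEquiv F n w) =
      glEquiv F n (bracket F (Fin n) z.1 w.2 + bracket F (Fin n) w.1 z.2) :=
  Subtype.ext <| by
    simp [lie₁₁, coe_glEquiv, coe_oddEquiv, fromBlocks_multiply, fromBlocks_add, bracket_apply,
      transpose_coe_symm, transpose_coe_skew, add_comm]

theorem pMap_glEquiv (s : Matrix (Fin n) (Fin n) F) :
    (g F n p).pMap (glEquiv F n s) = glEquiv F n (s ^ p) :=
  Subtype.ext <| by
    simp [pMap, coe_glEquiv, fromBlocks_diag_pow, neg_pow_char_of_algebra F p, transpose_pow]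

end Blocks

section Generators

variable {F : Type*} [Field F] {n : ℕ} (p : ℕ) [Fact p.Prime] [CharP F p]
  (χ : Module.Dual F (g₀ F n))

/-- The map `𝔤₀ → u_χ(𝔤)`, on `n × n` matrices. -/
def genZero : Matrix (Fin n) (Fin n) F →ₗ[F] (g F n p).Red χ :=
  (g F n p).ι₀ χ ∘ₗ (glEquiv F n).toLinearMap

/-- The map `𝔤₁ → u_χ(𝔤)`, on symmetric matrices. -/
def genPos : symm F (Fin n) →ₗ[F] (g F n p).Red χ :=
  (g F n p).ι₁ χ ∘ₗ (oddEquiv F n).toLinearMap ∘ₗ LinearMap.inl F _ _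

/-- The map `𝔤₋₁ → u_χ(𝔤)`, on skew-symmetric matrices. -/
def genNeg : skew F (Fin n) →ₗ[F] (g F n p).Red χ :=
  (g F n p).ι₁ χ ∘ₗ (oddEquiv F n).toLinearMap ∘ₗ LinearMap.inr F _ _

theorem ι₁_oddEquiv (z : symm F (Fin n) × skew F (Fin n)) :
    (g F n p).ι₁ χ (oddEquiv F n z) = genPos p χ z.1 + genNeg p χ z.2 := by
  conv_lhs => rw [← Prod.fst_add_snd z, map_add, map_add]
  rfl

theorem adjoin_range_gen : Algebra.adjoin F
    (Set.range (genZero p χ) ∪ Set.range (genPos p χ) ∪ Set.range (genNeg p χ)) = ⊤ := by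
  rw [eq_top_iff, ← adjoin_range_ι]
  refine Algebra.adjoin_le (Set.union_subset ?_ ?_)
  · refine (glEquiv F n).surjective.forall.2 ?_ |> Set.range_subset_iff.2
    exact fun s => Algebra.subset_adjoin (.inl (.inl ⟨s, rfl⟩))
  · refine Set.range_subset_iff.2 ((oddEquiv F n).surjective.forall.2 fun z => ?_)
    rw [SetLike.mem_coe, ι₁_oddEquiv]
    exact add_mem (Algebra.subset_adjoin (.inl (.inr ⟨z.1, rfl⟩)))
      (Algebra.subset_adjoin (.inr ⟨z.2, rfl⟩))

theorem gradedRelations_gen (h2 : IsUnit (2 : F)) :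
    GradedRelations (bracket F (Fin n)) (genZero p χ) (genPos p χ) (genNeg p χ) where
  a_mul_y s c := by
    have h := (g F n p).ι₀_mul_ι₁ χ (glEquiv F n s) (oddEquiv F n (0, c))
    rw [lie₀₁_glEquiv_oddEquiv, lie_zero, sub_eq_iff_eq_add'] at h
    exact h
  x_mul_y b c := by
    have h := (g F n p).ι₁_mul_ι₁ χ (oddEquiv F n (b, 0)) (oddEquiv F n (0, c))
    rw [lie₁₁_oddEquiv, map_zero, add_zero, ← eq_sub_iff_add_eq,
      sub_eq_neg_add] at h
    exact h
  isSquareZero c := by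
    have h := (g F n p).ι₁_mul_ι₁ χ (oddEquiv F n (0, c)) (oddEquiv F n (0, c))
    rw [lie₁₁_oddEquiv, map_zero, LinearMap.zero_apply, add_zero, map_zero, map_zero,
      ← two_smul F] at h
    exact h2.smul_eq_zero.1 h

end Generators

section KacModule

variable {F : Type*} [Field F] {n : ℕ} (p : ℕ) [Fact p.Prime] [CharP F p]
  (χ : Module.Dual F (g₀ F n)) (M : Type*) [AddCommGroup M] [Module F M]
  [Module ((gZero F n p).Red χ) M]

/-- The canonical map `m ↦ 1 ⊗ m` from `M` to its Kac module. -/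
def kacι : M →ₗ[F] KacModule F n p χ M :=
  (balance F n p χ M).mkQ.restrictScalars F ∘ₗ TensorProduct.mk F ((g F n p).Red χ) M 1

variable {M}

theorem smul_kacι (a : (g F n p).Red χ) (m : M) :
    a • kacι p χ M m = Submodule.Quotient.mk (a ⊗ₜ[F] m) := by
  change a • Submodule.Quotient.mk ((1 : (g F n p).Red χ) ⊗ₜ[F] m) = _
  rw [← Submodule.Quotient.mk_smul, TensorProduct.smul_tmul', smul_eq_mul, mul_one]

theorem incl_ι₀ (x : g₀ F n) :
    incl F n p χ ((gPlus F n p).ι₀ χ x) = (g F n p).ι₀ χ x :=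
  lift_ι₀ ..

theorem incl_ι₁ (b : symm F (Fin n)) :
    incl F n p χ ((gPlus F n p).ι₁ χ (posEquiv F n b)) = genPos p χ b :=
  lift_ι₁ ..

theorem proj_ι₀ (x : g₀ F n) :
    proj F n p χ ((gPlus F n p).ι₀ χ x) = (gZero F n p).ι₀ χ x :=
  lift_ι₀ ..

theorem proj_ι₁ (y : gPos F n) : proj F n p χ ((gPlus F n p).ι₁ χ y) = 0 :=
  lift_ι₁ ..

theorem incl_smul_kacι (s : (gPlus F n p).Red χ) (m : M) :
    incl F n p χ s • kacι p χ M m = kacι p χ M (proj F n p χ s • m) := by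
  rw [smul_kacι, ← one_mul (incl F n p χ s)]
  exact (Submodule.Quotient.eq _).2 (Submodule.subset_span ⟨1, s, m, rfl⟩)

theorem ι₀_smul_kacι (x : g₀ F n) (m : M) :
    (g F n p).ι₀ χ x • kacι p χ M m = kacι p χ M ((gZero F n p).ι₀ χ x • m) := by
  have h := incl_smul_kacι p χ ((gPlus F n p).ι₀ χ x) m
  rwa [incl_ι₀, proj_ι₀] at h

theorem genPos_smul_kacι (b : symm F (Fin n)) (m : M) : genPos p χ b • kacι p χ M m = 0 := by
  have h := incl_smul_kacι p χ ((gPlus F n p).ι₁ χ (posEquiv F n b)) m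
  rwa [incl_ι₁, proj_ι₁, zero_smul, map_zero] at h

variable (M) in
theorem span_range_kacι :
    Submodule.span ((g F n p).Red χ) (Set.range (kacι p χ M)) = ⊤ := by
  refine Submodule.eq_top_iff'.2 fun t => ?_
  obtain ⟨t, rfl⟩ := Submodule.Quotient.mk_surjective _ t
  induction t with
  | zero => exact zero_mem _
  | add s t hs ht => exact add_mem hs ht
  | tmul a m =>
    rw [← smul_kacι]
    exact Submodule.smul_mem _ a (Submodule.subset_span ⟨m, rfl⟩)

section Lift

variable [IsScalarTower F ((gZero F n p).Red χ) M]
  {K : Type*} [AddCommGroup K] [Module F K] [Module ((g F n p).Red χ) K]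
  [IsScalarTower F ((g F n p).Red χ) K] {j : M →ₗ[F] K}

theorem incl_smul_eq_of_forall_ι
    (h₀ : ∀ x m, (g F n p).ι₀ χ x • j m = j ((gZero F n p).ι₀ χ x • m))
    (h₁ : ∀ b m, genPos p χ b • j m = 0) (s : (gPlus F n p).Red χ) (m : M) :
    incl F n p χ s • j m = j (proj F n p χ s • m) := by
  have hs : s ∈ Algebra.adjoin F
      (Set.range ((gPlus F n p).ι₀ χ) ∪ Set.range ((gPlus F n p).ι₁ χ)) := by
    rw [adjoin_range_ι]
    exact Algebra.mem_top
  induction hs using Algebra.adjoin_induction generalizing m with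
  | mem s hs =>
    rcases hs with ⟨x, rfl⟩ | ⟨y, rfl⟩
    · rw [incl_ι₀, proj_ι₀, h₀]
    · obtain ⟨b, rfl⟩ := (posEquiv F n).surjective y
      rw [incl_ι₁, proj_ι₁, h₁, zero_smul, map_zero]
  | algebraMap r => simp only [AlgHom.commutes, algebraMap_smul, map_smul]
  | add s t _ _ hs ht => simp only [map_add, add_smul, hs, ht]
  | mul s t _ _ hs ht => simp only [map_mul, mul_smul, hs, ht]

omit [IsScalarTower F ((gZero F n p).Red χ) M] in
theorem exists_comp_kacι_eq
    (h : ∀ s m, incl F n p χ s • j m = j (proj F n p χ s • m)) :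
    ∃ f : KacModule F n p χ M →ₗ[(g F n p).Red χ] K, ∀ m, f (kacι p χ M m) = j m := by
  let f₀ : (g F n p).Red χ ⊗[F] M →ₗ[(g F n p).Red χ] K :=
    TensorProduct.AlgebraTensorModule.lift (LinearMap.toSpanSingleton _ _ j)
  have hf₀ (a : (g F n p).Red χ) (m : M) : f₀ (a ⊗ₜ m) = a • j m := rfl
  have hker : balance F n p χ M ≤ LinearMap.ker f₀ := by
    refine Submodule.span_le.2 ?_
    rintro _ ⟨a, s, m, rfl⟩
    rw [SetLike.mem_coe, LinearMap.mem_ker, map_sub, hf₀, hf₀, mul_smul, h, sub_self]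
  exact ⟨(balance F n p χ M).liftQ f₀ hker, fun m => (hf₀ 1 m).trans (one_smul _ _)⟩

end Lift

end KacModule

section Model

variable {F : Type*} [Field F] {n : ℕ} (p : ℕ) [Fact p.Prime] [CharP F p]
  (χ : Module.Dual F (g₀ F n)) (M : Type*) [AddCommGroup M] [Module F M]
  [Module ((gZero F n p).Red χ) M] [IsScalarTower F ((gZero F n p).Red χ) M]

/-- The representation of `gl(n) ≅ 𝔤₀` on a `u_χ(𝔤₀)`-module. -/
def glRep : Matrix (Fin n) (Fin n) F →ₗ⁅F⁆ Module.End F M where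
  toLinearMap := (Algebra.lsmul F F M).toLinearMap ∘ₗ (gZero F n p).ι₀ χ ∘ₗ
    (glEquiv F n).toLinearMap
  map_lie' {s t} := by
    have h := ((gZero F n p).ι₀_mul_ι₀ χ (glEquiv F n s) (glEquiv F n t)).trans
      (congrArg ((gZero F n p).ι₀ χ) (lie₀₀_glEquiv p s t))
    have h' := congrArg (Algebra.lsmul F F M) h
    rw [map_sub, map_mul, map_mul] at h'
    exact h'.symm

variable {M}

theorem glRep_apply (s : Matrix (Fin n) (Fin n) F) (m : M) :
    glRep p χ M s m = (gZero F n p).ι₀ χ (glEquiv F n s) • m := rfl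

theorem genZero_smul_kacι (s : Matrix (Fin n) (Fin n) F) (m : M) :
    genZero p χ s • kacι p χ M m = kacι p χ M (glRep p χ M s m) :=
  ι₀_smul_kacι p χ (glEquiv F n s) m

variable (M)

theorem glRep_pow_char_sub (s : Matrix (Fin n) (Fin n) F) :
    glRep p χ M s ^ p - glRep p χ M (s ^ p) = algebraMap F _ (χ (glEquiv F n s) ^ p) := by
  have h := (gZero F n p).ι₀_pow χ (glEquiv F n s)
  have h' := congrArg (Algebra.lsmul F F M) h
  rw [map_sub, map_pow, AlgHom.commutes] at h'
  rw [← h']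
  exact congrArg (fun x => glRep p χ M s ^ p - Algebra.lsmul F F M ((gZero F n p).ι₀ χ x))
    (pMap_glEquiv p s).symm

variable {M} in
theorem eq_bot_or_eq_top_of_glRep (hM : IsSimpleModule ((gZero F n p).Red χ) M)
    (S : Submodule F M) (hS : ∀ s, ∀ m ∈ S, glRep p χ M s m ∈ S) : S = ⊥ ∨ S = ⊤ := by
  refine (gZero F n p).eq_bot_or_eq_top_of_smul_mem χ hM S ?_ fun y m _ => ?_
  · exact (glEquiv F n).surjective.forall.2 hS
  · rw [Subsingleton.elim y 0, map_zero, zero_smul]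
    exact zero_mem S

/-- The model `Λ(𝔤₋₁) ⊗ M` of the Kac module, as a representation of `u_χ(𝔤)`. -/
def modelRep : (g F n p).Red χ →ₐ[F] Module.End F (ExteriorTensor F (skew F (Fin n)) M) :=
  (g F n p).lift χ
    ((evenOp (skew F (Fin n)) (glRep p χ M)).toLinearMap ∘ₗ (glEquiv F n).symm.toLinearMap)
    (oddOp (glRep p χ M) isGradedBracket_bracket ∘ₗ (oddEquiv F n).symm.toLinearMap)
    ((glEquiv F n).surjective.forall₂.2 fun s t => by
      rw [lie₀₀_glEquiv]
      simp [← LieRing.of_associative_ring_bracket])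
    ((glEquiv F n).surjective.forall.2 fun s => (oddEquiv F n).surjective.forall.2 fun z => by
      rw [lie₀₁_glEquiv_oddEquiv]
      simpa using evenOp_mul_oddOp_sub (glRep p χ M) isGradedBracket_bracket s z)
    ((oddEquiv F n).surjective.forall₂.2 fun z w => by
      rw [lie₁₁_oddEquiv]
      simpa using oddOp_mul_oddOp_add (glRep p χ M) isGradedBracket_bracket z w)
    ((glEquiv F n).surjective.forall.2 fun s => by
      rw [pMap_glEquiv]
      simpa using evenOp_pow_char_sub (glRep p χ M) (toEnd_skew_pow_char p s)
        (glRep_pow_char_sub p χ M s))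

theorem kacι_injective : Function.Injective (kacι p χ M) := by
  let _ : Module ((g F n p).Red χ) (ExteriorTensor F (skew F (Fin n)) M) :=
    Module.compHom _ (modelRep p χ M).toRingHom
  have : IsScalarTower F ((g F n p).Red χ) (ExteriorTensor F (skew F (Fin n)) M) :=
    ⟨fun r u k => LinearMap.congr_fun (map_smul (modelRep p χ M) r u) k⟩
  have h₀ : ∀ x m, (g F n p).ι₀ χ x • of F (skew F (Fin n)) M m =
      of F (skew F (Fin n)) M ((gZero F n p).ι₀ χ x • m) :=
    (glEquiv F n).surjective.forall.2 fun s m =>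
      (LinearMap.congr_fun (lift_ι₀ ..) _).trans (evenOp_of (skew F (Fin n)) (glRep p χ M) s m)
  have h₁ (b : symm F (Fin n)) (m : M) : genPos p χ b • of F (skew F (Fin n)) M m = 0 := by
    refine (LinearMap.congr_fun (lift_ι₁ ..) _).trans ?_
    change oddOp (glRep p χ M) isGradedBracket_bracket (b, 0) (of F (skew F (Fin n)) M m) = 0
    rw [oddOp_apply, map_zero, add_zero, posOp_of]
  obtain ⟨f, hf⟩ := exists_comp_kacι_eq p χ (incl_smul_eq_of_forall_ι p χ h₀ h₁)
  refine Function.Injective.of_comp (f := f) ?_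
  rw [show f ∘ kacι p χ M = of F (skew F (Fin n)) M from funext hf]
  exact of_injective F (skew F (Fin n)) M

end Model

section Simplicity

variable {F : Type*} [Field F] {n : ℕ} {p : ℕ} [Fact p.Prime] [CharP F p]
  {χ : Module.Dual F (g₀ F n)} {M : Type*} [AddCommGroup M] [Module F M]
  [Module ((gZero F n p).Red χ) M] [IsScalarTower F ((gZero F n p).Red χ) M]

theorem isSingular_kacι {v : M} {μ : Fin n → F} (hv : IsMaximalVector p χ v μ) :
    IsSingular (genZero p χ) (genPos p χ) (kacι p χ M v) μ where
  single_smul i j hij := by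
    rw [genZero_smul_kacι, glRep_apply]
    exact (congrArg _ (hv.2.1 _ (Submodule.subset_span ⟨i, j, hij, rfl⟩))).trans (map_zero _)
  x_smul b := genPos_smul_kacι p χ b v
  diag_smul i := by
    rw [genZero_smul_kacι, glRep_apply, ← map_smul]
    exact congrArg _ (hv.2.2 i)

theorem eq_top_of_kacι_mem (hM : IsSimpleModule ((gZero F n p).Red χ) M)
    {N : Submodule ((g F n p).Red χ) (KacModule F n p χ M)} {v : M} (hv : v ≠ 0)
    (hvN : kacι p χ M v ∈ N) : N = ⊤ := by
  let S : Submodule F M := (N.restrictScalars F).comap (kacι p χ M)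
  have hgl (s : Matrix (Fin n) (Fin n) F) (m : M) (hm : m ∈ S) : glRep p χ M s m ∈ S := by
    change kacι p χ M _ ∈ N
    rw [← genZero_smul_kacι]
    exact N.smul_mem _ hm
  have hS : S = ⊤ := (eq_bot_or_eq_top_of_glRep p χ hM S hgl).resolve_left
    ((Submodule.ne_bot_iff S).2 ⟨v, hvN, hv⟩)
  rw [eq_top_iff, ← span_range_kacι, Submodule.span_le]
  rintro _ ⟨m, rfl⟩
  exact (hS ▸ Submodule.mem_top : m ∈ S)

theorem isUnit_of_delta_ne_zero {μ : Fin n → F} (hδ : delta μ ≠ 0) (i j : Fin n) (hij : i < j) :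
    IsUnit (μ i - μ j + ((j : ℕ) : F) - ((i : ℕ) : F) - 1) :=
  (Finset.prod_ne_zero_iff.1 (Finset.prod_ne_zero_iff.1 hδ i (Finset.mem_univ i)) j
    (Finset.mem_Ioi.2 hij)).isUnit

end Simplicity

end Periplectic

open Periplectic

theorem proposition2p3_general {F : Type*} [Field F] (p : ℕ) [Fact p.Prime] [CharP F p]
    (hp : 2 < p) (n : ℕ) (χ : Module.Dual F (g₀ F n))
    {M : Type*} [AddCommGroup M] [Module F M] [Module ((gZero F n p).Red χ) M]
    [IsScalarTower F ((gZero F n p).Red χ) M] (hM : IsSimpleModule ((gZero F n p).Red χ) M)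
    (μ : Fin n → F) (v : M) (hv : IsMaximalVector p χ v μ) (hδ : delta μ ≠ 0) :
    IsSimpleModule ((g F n p).Red χ) (KacModule F n p χ M) := by
  have h2 : IsUnit (2 : F) :=
    (Ring.two_ne_zero ((ringChar.eq F p).symm ▸ hp.ne')).isUnit
  obtain ⟨L, hL, hmem⟩ := exists_isFinalSegment n
  have hrel := gradedRelations_gen p χ h2
  have : Nontrivial (KacModule F n p χ M) :=
    ⟨kacι p χ M v, 0, (map_ne_zero_iff _ (kacι_injective p χ M)).2 hv.1⟩
  refine { eq_bot_or_eq_top := fun N => or_iff_not_imp_left.2 fun hN => ?_ }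
  have hprod : rootProd (genNeg p χ) L • kacι p χ M v ∈ N :=
    hrel.prod_map_smul_mem (adjoin_range_gen p χ) (eq_bot_or_eq_top_of_glRep p χ hM)
      (genZero_smul_kacι p χ) (genPos_smul_kacι p χ) (span_range_kacι p χ M)
      (span_skewUnits_eq_top h2 hmem) hN v
  have hvN : kacι p χ M v ∈ N :=
    (isSingular_kacι hv).mem_of_rootProd_smul_mem hrel (isUnit_of_delta_ne_zero hδ) hL hprod
  exact eq_top_of_kacι_mem hM hv.1 hvN

end

theorem proposition2p3 {F : Type*} [Field F] [IsAlgClosed F] (p : ℕ) [Fact p.Prime] [CharP F p]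
    (hp : 2 < p) (n : ℕ) (hn : 2 ≤ n)
    (χ : Module.Dual F (Periplectic.g₀ F n)) (hχ : ∀ x ∈ Periplectic.nPlus F n, χ x = 0)
    {M : Type*} [AddCommGroup M] [Module F M] [Module ((Periplectic.gZero F n p).Red χ) M]
    [IsScalarTower F ((Periplectic.gZero F n p).Red χ) M]
    (hM : IsSimpleModule ((Periplectic.gZero F n p).Red χ) M)
    (μ : Fin n → F) (v : M) (hv : Periplectic.IsMaximalVector p χ v μ)
    (hgen : Submodule.span ((Periplectic.gZero F n p).Red χ) {v} = ⊤)
    (hδ : Periplectic.delta μ ≠ 0) :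
    IsSimpleModule ((Periplectic.g F n p).Red χ) (Periplectic.KacModule F n p χ M) := by
  exact proposition2p3_general p hp n χ hM μ v hv hδ
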